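/- Let $n\ge 0$ and equip $\mathbb{C}^n\oplus\mathbb{C}^n$ with the Hermitian symplectic form $\omega\big((x_1,x_2),(y_1,y_2)\big)=\langle x_1,y_2\rangle-\langle x_2,y_1\rangle$. A complex subspace $\mathcal{L}$ is a \emph{Lagrangian plane} if $\mathcal{L}=\{v:\omega(u,v)=0\text{ for all }u\in\mathcal{L}\}$; a \emph{symplectic transformation} is a complex-linear bijection $\mathsf{S}$ of $\mathbb{C}^n\oplus\mathbb{C}^n$ with $\omega(\mathsf{S}x,\mathsf{S}y)=\omega(x,y)$ for all $x,y$. The \emph{Duistermaat index} of three Lagrangian planes is the integer $$\iota(\mathcal{L}_1,\mathcal{L}_2,\mathcal{L}_3)=n_-(\Omega)-n+\dim(\mathcal{L}_1\cap\mathcal{L}_3),$$ where $n_-(\Omega)$ is the largest dimension of a subspace on which the Hermitian form $$\Omega(x_1,x_2,x_3;y_1,y_2,y_3)=\omega(x_1,y_2)+\omega(x_2,y_3)+\omega(x_3,y_1)-\omega(x_2,y_1)-\omega(x_3,y_2)-\omega(x_1,y_3)$$ on $\mathcal{L}_1\oplus\mathcal{L}_2\oplus\mathcal{L}_3$ is negative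 definite. Equivalently, $\iota$ is the unique integer-valued function of triples of Lagrangian planes that is invariant under symplectic transformations, satisfies $\iota(\mathcal{L}_1,\mathcal{L}_2,\mathcal{L}_3)-\iota(\mathcal{L}_1,\mathcal{L}_2,\mathcal{L}_4)+\iota(\mathcal{L}_1,\mathcal{L}_3,\mathcal{L}_4)-\iota(\mathcal{L}_2,\mathcal{L}_3,\mathcal{L}_4)=0$, and, for every Hermitian matrix $A$, takes on the triple $\mathbb{C}^n\oplus 0$, $\{(x,Ax):x\in\mathbb{C}^n\}$, $0\oplus\mathbb{C}^n$ the number of negative eigenvalues of $A$ as its value. For any two triples $(\mathcal{L}_1,\mathcal{L}_2,\mathcal{L}_3)$ and $(\mathcal{M}_1,\mathcal{M}_2,\mathcal{M}_3)$ of Lagrangian planes in $\mathbb{C}^n\oplus\mathbb{C}^n$, there is a symplectic transformation $\mathsf{S}$ with $\mathsf{S}\mathcal{L}_j=\mathcal{M}_j$ for all $j\in\{1,2,3\}$ if and only if $$\dim(\mathcal{L}_j\cap\mathcal{L}_k)=\dim(\mathcal{M}_j\cap\mathcal{M}_k)\quad\text{for all }j,k\in\{1,2,3\},$$ $$\dim(\mathcal{L}_1\cap\mathcal{L}_2\cap\mathcal{L}_3)=\dim(\mathcal{M}_1\cap\mathcal{M}_2\cap\mathcal{M}_3),\qquad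 \iota(\mathcal{L}_1,\mathcal{L}_2,\mathcal{L}_3)=\iota(\mathcal{M}_1,\mathcal{M}_2,\mathcal{M}_3).$$ -/

import Mathlib

/-- `ℂⁿ` with its standard inner product (conjugate-linear in the first argument). -/
abbrev Cn (n : ℕ) : Type := EuclideanSpace ℂ (Fin n)

/-- The canonical (Hermitian) symplectic form on `ℂⁿ ⊕ ℂⁿ`,
`ω((x₁,x₂),(y₁,y₂)) = ⟨x₁,y₂⟩ - ⟨x₂,y₁⟩`. -/
noncomputable def sympForm (n : ℕ) :
    (Cn n × Cn n) →ₗ⋆[ℂ] (Cn n × Cn n) →ₗ[ℂ] ℂ :=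
  LinearMap.mk₂'ₛₗ (starRingEnd ℂ) (RingHom.id ℂ)
    (fun x y => inner ℂ x.1 y.2 - inner ℂ x.2 y.1)
    (by intro a b c; simp only [Prod.fst_add, Prod.snd_add, inner_add_left]; ring)
    (by intro c a b; simp only [Prod.smul_fst, Prod.smul_snd, inner_smul_left, smul_eq_mul]; ring)
    (by intro a b c; simp only [Prod.fst_add, Prod.snd_add, inner_add_right]; ring)
    (by intro c a b; simp only [Prod.smul_fst, Prod.smul_snd, inner_smul_right, smul_eq_mul,
          RingHom.id_apply]; ring)

theorem sympForm_apply {n : ℕ} (x y : Cn n × Cn n) :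
    sympForm n x y = inner ℂ x.1 y.2 - inner ℂ x.2 y.1 := rfl

/-- A complex subspace is Lagrangian if it coincides with its symplectic complement
`{v | ∀ u ∈ L, ω(u, v) = 0}`. -/
def IsLagrangian {n : ℕ} (L : Submodule ℂ (Cn n × Cn n)) : Prop :=
  L = L.orthogonalBilin (sympForm n)

theorem IsLagrangian.mem_iff {n : ℕ} {L : Submodule ℂ (Cn n × Cn n)} (hL : IsLagrangian L)
    (v : Cn n × Cn n) : v ∈ L ↔ ∀ u ∈ L, sympForm n u v = 0 := by
  conv_lhs => rw [show L = L.orthogonalBilin (sympForm n) from hL]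
  rfl

theorem isLagrangian_of_mem_iff {n : ℕ} {L : Submodule ℂ (Cn n × Cn n)}
    (h : ∀ v, v ∈ L ↔ ∀ u ∈ L, sympForm n u v = 0) : IsLagrangian L :=
  Submodule.ext h

/-- The set `Λ(n)` of Lagrangian planes of `ℂⁿ ⊕ ℂⁿ`. -/
abbrev LagrangianPlane (n : ℕ) : Type := {L : Submodule ℂ (Cn n × Cn n) // IsLagrangian L}

/-- A linear symplectic transformation of `ℂⁿ ⊕ ℂⁿ`. -/
def IsSymplectic {n : ℕ} (S : (Cn n × Cn n) ≃ₗ[ℂ] (Cn n × Cn n)) : Prop :=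
  ∀ x y, sympForm n (S x) (S y) = sympForm n x y

/-- The image `S L` of a Lagrangian plane under a symplectic transformation. -/
def LagrangianPlane.map {n : ℕ} (L : LagrangianPlane n)
    (S : (Cn n × Cn n) ≃ₗ[ℂ] (Cn n × Cn n)) (hS : IsSymplectic S) : LagrangianPlane n :=
  ⟨L.1.map (S : (Cn n × Cn n) →ₗ[ℂ] (Cn n × Cn n)), by
    apply isLagrangian_of_mem_iff
    intro v
    obtain ⟨w, rfl⟩ := S.surjective v
    simp only [Submodule.mem_map, LinearEquiv.coe_coe, S.injective.eq_iff, exists_eq_right]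
    rw [L.2.mem_iff]
    constructor
    · rintro h _ ⟨u, hu, rfl⟩
      rw [hS]; exact h u hu
    · intro h u hu
      rw [← hS]; exact h _ ⟨u, hu, rfl⟩⟩

/-- The Hermitian form `Ω` on `L₁ ⊕ L₂ ⊕ L₃`. -/
noncomputable def tripleForm {n : ℕ} (L₁ L₂ L₃ : Submodule ℂ (Cn n × Cn n)) :
    (L₁ × L₂ × L₃) →ₗ⋆[ℂ] (L₁ × L₂ × L₃) →ₗ[ℂ] ℂ :=
  LinearMap.mk₂'ₛₗ (starRingEnd ℂ) (RingHom.id ℂ)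
    (fun x y => sympForm n x.1 y.2.1 + sympForm n x.2.1 y.2.2 + sympForm n x.2.2 y.1
      - sympForm n x.2.1 y.1 - sympForm n x.2.2 y.2.1 - sympForm n x.1 y.2.2)
    (by intro a b c
        simp only [Prod.fst_add, Prod.snd_add, Submodule.coe_add, map_add, LinearMap.add_apply]
        ring)
    (by intro c a b
        simp only [Prod.smul_fst, Prod.smul_snd, Submodule.coe_smul, LinearMap.map_smulₛₗ,
          LinearMap.smul_apply, smul_eq_mul]
        ring)
    (by intro a b c
        simp only [Prod.fst_add, Prod.snd_add, Submodule.coe_add, map_add]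
        ring)
    (by intro c a b
        simp only [Prod.smul_fst, Prod.smul_snd, Submodule.coe_smul, map_smul, smul_eq_mul,
          RingHom.id_apply]
        ring)

/-- The Morse index `n₋` of the (real-valued) quadratic form `q` of a Hermitian form: the largest
dimension of a complex subspace on which `q` is negative definite. -/
noncomputable def negIndex {F : Type*} [AddCommGroup F] [Module ℂ F] (q : F → ℝ) : ℕ :=
  sSup {d | ∃ W : Submodule ℂ F, Module.finrank ℂ W = d ∧ ∀ w ∈ W, w ≠ 0 → q w < 0}

/-- The Duistermaat index `n₋(Ω) - n + dim (L₁ ∩ L₃)`.  By `isDuistermaatIndex_duistermaatIndex`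
and `IsDuistermaatIndex.eq` below it is the unique function on triples of Lagrangian planes that
satisfies normalization, symplectic invariance and the cocycle identity. -/
noncomputable def duistermaatIndex {n : ℕ} (L₁ L₂ L₃ : LagrangianPlane n) : ℤ :=
  (negIndex (fun x => (tripleForm L₁.1 L₂.1 L₃.1 x x).re) : ℤ) - n
    + (Module.finrank ℂ (L₁.1 ⊓ L₃.1 : Submodule ℂ (Cn n × Cn n)) : ℤ)

/-! ### The axioms that characterize the Duistermaat index -/

theorem inner_toEuclideanLin {n : ℕ} {A : Matrix (Fin n) (Fin n) ℂ} (hA : A.IsHermitian)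
    (x y : Cn n) : inner ℂ (Matrix.toEuclideanLin A x) y = inner ℂ x (Matrix.toEuclideanLin A y) :=
  (Matrix.isSymmetric_toEuclideanLin_iff.2 hA) x y

/-- The graph `{(x, A x)}` of a Hermitian matrix, a Lagrangian plane. -/
noncomputable def graphPlane {n : ℕ} (A : Matrix (Fin n) (Fin n) ℂ) (hA : A.IsHermitian) :
    LagrangianPlane n :=
  ⟨(Matrix.toEuclideanLin A).graph, by
    apply isLagrangian_of_mem_iff
    rintro ⟨x, y⟩
    rw [LinearMap.mem_graph_iff]
    constructor
    · rintro h ⟨u, v⟩ huv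
      rw [LinearMap.mem_graph_iff] at huv
      simp only at h huv
      rw [sympForm_apply]
      simp only
      rw [h, huv, inner_toEuclideanLin hA, sub_self]
    · intro h
      refine ext_inner_left ℂ fun u => ?_
      have := h (u, Matrix.toEuclideanLin A u) (by rw [LinearMap.mem_graph_iff])
      rw [sympForm_apply] at this
      simp only at this ⊢
      rw [← inner_toEuclideanLin hA]
      exact sub_eq_zero.1 this⟩

/-- The vertical plane `0 ⊕ ℂⁿ`. -/
noncomputable def verticalPlane (n : ℕ) : LagrangianPlane n :=
  ⟨(⊥ : Submodule ℂ (Cn n)).prod ⊤, by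
    apply isLagrangian_of_mem_iff
    rintro ⟨x, y⟩
    simp only [Submodule.mem_prod, Submodule.mem_bot, Submodule.mem_top, and_true]
    constructor
    · rintro rfl ⟨u, v⟩ hu
      simp only at hu
      rw [sympForm_apply]
      simp [hu]
    · intro h
      refine ext_inner_left ℂ fun u => ?_
      have := h (0, u) rfl
      rw [sympForm_apply] at this
      simpa using this⟩

/-- The number of negative eigenvalues (with multiplicity) of a Hermitian matrix. -/
noncomputable def morseIndex {n : ℕ} {A : Matrix (Fin n) (Fin n) ℂ} (hA : A.IsHermitian) : ℕ :=
  Nat.card {i // hA.eigenvalues i < 0}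

/-- The axioms of the Duistermaat index. -/
structure IsDuistermaatIndex {n : ℕ}
    (i : LagrangianPlane n → LagrangianPlane n → LagrangianPlane n → ℤ) : Prop where
  normalization : ∀ (A : Matrix (Fin n) (Fin n) ℂ) (hA : A.IsHermitian),
    i (graphPlane 0 Matrix.isHermitian_zero) (graphPlane A hA) (verticalPlane n) = morseIndex hA
  invariance : ∀ (S : (Cn n × Cn n) ≃ₗ[ℂ] (Cn n × Cn n)) (hS : IsSymplectic S)
    (L₁ L₂ L₃ : LagrangianPlane n), i (L₁.map S hS) (L₂.map S hS) (L₃.map S hS) = i L₁ L₂ L₃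
  cocycle : ∀ L₁ L₂ L₃ L₄ : LagrangianPlane n,
    i L₁ L₂ L₃ - i L₁ L₂ L₄ + i L₁ L₃ L₄ - i L₂ L₃ L₄ = 0

/-- `q` has negative index `d`, witnessed by a splitting into a negative definite subspace of
dimension `d` and a nonnegative one of complementary dimension. -/
def HasNegIndex {F : Type*} [AddCommGroup F] [Module ℂ F] (q : F → ℝ) (d : ℕ) : Prop :=
  ∃ N P : Submodule ℂ F, (∀ w ∈ N, w ≠ 0 → q w < 0) ∧ (∀ w ∈ P, 0 ≤ q w) ∧
    Module.finrank ℂ N = d ∧ Module.finrank ℂ N + Module.finrank ℂ P = Module.finrank ℂ F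

theorem HasNegIndex.negIndex_eq {F : Type*} [AddCommGroup F] [Module ℂ F] [FiniteDimensional ℂ F]
    {q : F → ℝ} {d : ℕ} (h : HasNegIndex q d) : negIndex q = d := by
  obtain ⟨N, P, hN, hP, hd, hs⟩ := h
  have hub : ∀ e ∈ {e | ∃ W : Submodule ℂ F, Module.finrank ℂ W = e ∧ ∀ w ∈ W, w ≠ 0 → q w < 0},
      e ≤ d := by
    rintro e ⟨W, rfl, hW⟩
    have hdis : Disjoint W P := by
      rw [Submodule.disjoint_def]
      intro x hx hx'
      by_contra h0
      exact absurd (hP x hx') (not_le.2 (hW x hx h0))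
    have := Submodule.finrank_add_finrank_le_of_disjoint hdis
    omega
  exact le_antisymm (csSup_le ⟨d, N, hd, hN⟩ hub) (le_csSup ⟨d, hub⟩ ⟨N, hd, hN⟩)

theorem HasNegIndex.comp {F G : Type*} [AddCommGroup F] [Module ℂ F] [AddCommGroup G] [Module ℂ G]
    {q : F → ℝ} {d : ℕ} (h : HasNegIndex q d) (e : G ≃ₗ[ℂ] F) {r : G → ℝ} {c : ℝ} (hc : 0 < c)
    (hr : ∀ x, r x = c * q (e x)) : HasNegIndex r d := by
  obtain ⟨N, P, hN, hP, hd, hs⟩ := h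
  refine ⟨N.map (e.symm : F →ₗ[ℂ] G), P.map (e.symm : F →ₗ[ℂ] G), ?_, ?_, ?_, ?_⟩
  · rintro _ ⟨w, hw, rfl⟩ h0
    rw [hr]
    simp only [LinearEquiv.coe_coe, LinearEquiv.apply_symm_apply]
    refine mul_neg_of_pos_of_neg hc (hN w hw ?_)
    rintro rfl
    simp at h0
  · rintro _ ⟨w, hw, rfl⟩
    rw [hr]
    simp only [LinearEquiv.coe_coe, LinearEquiv.apply_symm_apply]
    exact mul_nonneg hc.le (hP w hw)
  · rw [LinearEquiv.finrank_map_eq]; exact hd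
  · rw [LinearEquiv.finrank_map_eq, LinearEquiv.finrank_map_eq, hs, e.finrank_eq]

theorem finrank_submodule_prod {F G : Type*} [AddCommGroup F] [Module ℂ F] [AddCommGroup G]
    [Module ℂ G] [FiniteDimensional ℂ F] [FiniteDimensional ℂ G]
    (N : Submodule ℂ F) (P : Submodule ℂ G) :
    Module.finrank ℂ (N.prod P) = Module.finrank ℂ N + Module.finrank ℂ P := by
  rw [← Module.finrank_prod]
  exact LinearEquiv.finrank_eq
    { toFun := fun x => (⟨x.1.1, x.2.1⟩, ⟨x.1.2, x.2.2⟩)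
      invFun := fun y => ⟨(y.1.1, y.2.1), y.1.2, y.2.2⟩
      map_add' := fun _ _ => rfl
      map_smul' := fun _ _ => rfl
      left_inv := fun _ => rfl
      right_inv := fun _ => rfl }

theorem HasNegIndex.prod {F G : Type*} [AddCommGroup F] [Module ℂ F] [AddCommGroup G]
    [Module ℂ G] [FiniteDimensional ℂ F] [FiniteDimensional ℂ G] {q : F → ℝ} {r : G → ℝ} {d e : ℕ}
    (hq : HasNegIndex q d) (hr : HasNegIndex r e) (hq0 : q 0 = 0) (hr0 : r 0 = 0) :
    HasNegIndex (fun x : F × G => q x.1 + r x.2) (d + e) := by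
  obtain ⟨N, P, hN, hP, hd, hs⟩ := hq
  obtain ⟨N', P', hN', hP', hd', hs'⟩ := hr
  refine ⟨N.prod N', P.prod P', ?_, ?_, ?_, ?_⟩
  · rintro ⟨x, y⟩ ⟨hx, hy⟩ h0
    simp only at hx hy ⊢
    by_cases hx0 : x = 0
    · have hy0 : y ≠ 0 := fun h => h0 (by rw [hx0, h]; rfl)
      rw [hx0, hq0, zero_add]; exact hN' y hy hy0
    · have h1 := hN x hx hx0
      by_cases hy0 : y = 0
      · rw [hy0, hr0, add_zero]; exact h1
      · have h2 := hN' y hy hy0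
        linarith
  · rintro ⟨x, y⟩ ⟨hx, hy⟩
    exact add_nonneg (hP x hx) (hP' y hy)
  · rw [finrank_submodule_prod, hd, hd']
  · rw [finrank_submodule_prod, finrank_submodule_prod, Module.finrank_prod]; omega

/-- The quadratic form of a matrix. -/
noncomputable def matQuad {n : ℕ} (A : Matrix (Fin n) (Fin n) ℂ) (x : Cn n) : ℝ :=
  (inner ℂ x (Matrix.toEuclideanLin A x)).re

theorem matQuad_zero {n : ℕ} (A : Matrix (Fin n) (Fin n) ℂ) : matQuad A 0 = 0 := by
  simp [matQuad]

theorem matQuad_eq_sum {n : ℕ} {A : Matrix (Fin n) (Fin n) ℂ} (hA : A.IsHermitian) (x : Cn n) :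
    matQuad A x = ∑ i, hA.eigenvalues i * ‖hA.eigenvectorBasis.repr x i‖ ^ 2 := by
  have key : ∀ i, inner ℂ (hA.eigenvectorBasis i) (Matrix.toEuclideanLin A x)
      = hA.eigenvalues i * hA.eigenvectorBasis.repr x i := by
    intro i
    have h1 : Matrix.toEuclideanLin A (hA.eigenvectorBasis i)
        = (hA.eigenvalues i : ℂ) • hA.eigenvectorBasis i := by
      ext j
      have := congrFun (hA.mulVec_eigenvectorBasis i) j
      simpa using this
    rw [← inner_toEuclideanLin hA, h1, inner_smul_left, Complex.conj_ofReal,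
      OrthonormalBasis.repr_apply_apply]
  unfold matQuad
  rw [← hA.eigenvectorBasis.sum_inner_mul_inner, Complex.re_sum]
  refine Finset.sum_congr rfl fun i _ => ?_
  rw [key, ← inner_conj_symm, ← OrthonormalBasis.repr_apply_apply]
  set z := hA.eigenvectorBasis.repr x i
  rw [show (starRingEnd ℂ) z * ((hA.eigenvalues i : ℂ) * z)
    = (hA.eigenvalues i : ℂ) * ((starRingEnd ℂ) z * z) by ring, Complex.conj_mul']
  norm_cast

/-- Vectors whose coordinates in the basis `b` are supported in `s`. -/
noncomputable def coordSpan {n : ℕ} (b : OrthonormalBasis (Fin n) ℂ (Cn n)) (s : Set (Fin n)) :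
    Submodule ℂ (Cn n) := Submodule.span ℂ (b '' s)

theorem finrank_coordSpan {n : ℕ} (b : OrthonormalBasis (Fin n) ℂ (Cn n)) (s : Set (Fin n)) :
    Module.finrank ℂ (coordSpan b s) = Nat.card s := by
  classical
  have hli : LinearIndependent ℂ (fun i : s => b i) :=
    b.orthonormal.linearIndependent.comp _ Subtype.val_injective
  have h := finrank_span_eq_card hli
  rw [coordSpan, Nat.card_eq_fintype_card, ← h, Set.image_eq_range]

theorem repr_of_mem_coordSpan {n : ℕ} (b : OrthonormalBasis (Fin n) ℂ (Cn n)) (s : Set (Fin n))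
    {x : Cn n} (hx : x ∈ coordSpan b s) (i : Fin n) (hi : i ∉ s) : b.repr x i = 0 := by
  induction hx using Submodule.span_induction with
  | mem x h =>
    obtain ⟨j, hj, rfl⟩ := h
    have : j ≠ i := fun h => hi (h ▸ hj)
    rw [OrthonormalBasis.repr_apply_apply]
    exact b.orthonormal.2 this.symm
  | zero => simp
  | add x y _ _ hx hy => simp [hx, hy]
  | smul c x _ hx => simp [hx]

theorem card_set_add_compl {n : ℕ} (s : Set (Fin n)) :
    Nat.card s + Nat.card (sᶜ : Set (Fin n)) = n := by
  have := Set.ncard_add_ncard_compl s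
  simpa [Set.ncard] using this

theorem hasNegIndex_of_diag {n : ℕ} (b : OrthonormalBasis (Fin n) ℂ (Cn n)) (l : Fin n → ℝ)
    (q : Cn n → ℝ) (hq : ∀ x, q x = ∑ i, l i * ‖b.repr x i‖ ^ 2) :
    HasNegIndex q (Nat.card {i // l i < 0}) := by
  refine ⟨coordSpan b {i | l i < 0}, coordSpan b {i | l i < 0}ᶜ, ?_, ?_, ?_, ?_⟩
  · intro x hx h0
    rw [hq]
    have hle : ∀ i, l i * ‖b.repr x i‖ ^ 2 ≤ 0 := by
      intro i
      by_cases hi : l i < 0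
      · exact mul_nonpos_of_nonpos_of_nonneg hi.le (by positivity)
      · rw [repr_of_mem_coordSpan b _ hx i hi]; simp
    obtain ⟨i, hi⟩ : ∃ i, b.repr x i ≠ 0 := by
      by_contra! hc
      apply h0
      have : b.repr x = 0 := by ext i; exact hc i
      simpa using this
    have hli : l i < 0 := by
      by_contra hli
      exact hi (repr_of_mem_coordSpan b _ hx i hli)
    refine Finset.sum_neg' (fun i _ => hle i) ⟨i, Finset.mem_univ i, ?_⟩
    exact mul_neg_of_neg_of_pos hli (by positivity)
  · intro x hx
    rw [hq]
    refine Finset.sum_nonneg fun i _ => ?_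
    by_cases hi : l i < 0
    · rw [repr_of_mem_coordSpan b _ hx i (fun h => h hi)]; simp
    · exact mul_nonneg (not_lt.1 hi) (by positivity)
  · rw [finrank_coordSpan]; rfl
  · rw [finrank_coordSpan, finrank_coordSpan, card_set_add_compl]; simp

theorem hasNegIndex_matQuad {n : ℕ} {A : Matrix (Fin n) (Fin n) ℂ} (hA : A.IsHermitian) :
    HasNegIndex (matQuad A) (morseIndex hA) :=
  hasNegIndex_of_diag hA.eigenvectorBasis hA.eigenvalues _ (matQuad_eq_sum hA)

/-- `n₋(-A) = n - dim ker A - n₋(A)`. -/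
theorem morseIndex_neg {n : ℕ} {A : Matrix (Fin n) (Fin n) ℂ} (hA : A.IsHermitian)
    (hA' : (-A).IsHermitian) :
    morseIndex hA' + morseIndex hA + Module.finrank ℂ (Matrix.toEuclideanLin A).ker = n := by
  have h1 : morseIndex hA' = Nat.card {i // 0 < hA.eigenvalues i} := by
    have h := hasNegIndex_of_diag hA.eigenvectorBasis (fun i => - hA.eigenvalues i) (matQuad (-A))
      (fun x => by
        have := matQuad_eq_sum hA x
        simp only [matQuad] at this ⊢
        simp [this])
    rw [← (hasNegIndex_matQuad hA').negIndex_eq, h.negIndex_eq]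
    simp
  have h2 : Module.finrank ℂ (Matrix.toEuclideanLin A).ker + Nat.card {i // hA.eigenvalues i ≠ 0}
      = n := by
    have h3 := (Matrix.toEuclideanLin A).finrank_range_add_finrank_ker
    have h4 := hA.rank_eq_card_non_zero_eigs
    rw [Matrix.rank_eq_finrank_range_toLin A (EuclideanSpace.basisFun (Fin n) ℂ).toBasis
      (EuclideanSpace.basisFun (Fin n) ℂ).toBasis,
      ← Matrix.toEuclideanLin_eq_toLin_orthonormal] at h4
    rw [Nat.card_eq_fintype_card, ← h4]
    simp only [finrank_euclideanSpace, Fintype.card_fin] at h3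
    omega
  have h5 : Nat.card {i // hA.eigenvalues i ≠ 0}
      = Nat.card {i // hA.eigenvalues i < 0} + Nat.card {i // 0 < hA.eigenvalues i} := by
    classical
    rw [Nat.card_eq_fintype_card, Nat.card_eq_fintype_card, Nat.card_eq_fintype_card,
      ← Fintype.card_subtype_or_disjoint]
    · exact Fintype.card_congr (Equiv.subtypeEquivRight fun i => ne_iff_lt_or_gt)
    · rw [Pi.disjoint_iff]
      intro i
      rw [Prop.disjoint_iff]
      exact fun h => lt_asymm h.1 h.2
  rw [h1, morseIndex]
  omega

/-- The shear `(x₁, x₂) ↦ (x₁, x₂ + A x₁)`. -/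
noncomputable def shearDown {n : ℕ} (A : Matrix (Fin n) (Fin n) ℂ) :
    (Cn n × Cn n) ≃ₗ[ℂ] (Cn n × Cn n) :=
  LinearEquiv.ofLinearMap
    (LinearMap.prod (LinearMap.fst ℂ _ _)
      (LinearMap.snd ℂ _ _ + (Matrix.toEuclideanLin A) ∘ₗ LinearMap.fst ℂ _ _))
    (LinearMap.prod (LinearMap.fst ℂ _ _)
      (LinearMap.snd ℂ _ _ - (Matrix.toEuclideanLin A) ∘ₗ LinearMap.fst ℂ _ _))
    (by ext x : 2 <;> simp) (by ext x : 2 <;> simp)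

theorem shearDown_apply {n : ℕ} (A : Matrix (Fin n) (Fin n) ℂ) (x : Cn n × Cn n) :
    shearDown A x = (x.1, x.2 + Matrix.toEuclideanLin A x.1) := rfl

theorem isSymplectic_shearDown {n : ℕ} {A : Matrix (Fin n) (Fin n) ℂ} (hA : A.IsHermitian) :
    IsSymplectic (shearDown A) := by
  intro x y
  simp only [sympForm_apply, shearDown_apply, inner_add_left, inner_add_right]
  rw [inner_toEuclideanLin hA]
  ring

/-- The shear `(x₁, x₂) ↦ (x₁ + ε x₂, x₂)` with real `ε`. -/
noncomputable def shearUp (n : ℕ) (ε : ℝ) : (Cn n × Cn n) ≃ₗ[ℂ] (Cn n × Cn n) :=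
  LinearEquiv.ofLinearMap
    (LinearMap.prod (LinearMap.fst ℂ _ _ + (ε : ℂ) • LinearMap.snd ℂ _ _) (LinearMap.snd ℂ _ _))
    (LinearMap.prod (LinearMap.fst ℂ _ _ - (ε : ℂ) • LinearMap.snd ℂ _ _) (LinearMap.snd ℂ _ _))
    (by ext x : 2 <;> simp) (by ext x : 2 <;> simp)

theorem shearUp_apply {n : ℕ} (ε : ℝ) (x : Cn n × Cn n) :
    shearUp n ε x = (x.1 + (ε : ℂ) • x.2, x.2) := rfl

theorem isSymplectic_shearUp (n : ℕ) (ε : ℝ) : IsSymplectic (shearUp n ε) := by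
  intro x y
  simp only [sympForm_apply, shearUp_apply, inner_add_left, inner_add_right, inner_smul_left,
    inner_smul_right, Complex.conj_ofReal]
  ring

/-- The parameters `ε` for which the sheared plane is not a graph form a finite set. -/
theorem finite_bad_shear {n : ℕ} (L : LagrangianPlane n) :
    {ε : ℝ | ∃ y : Cn n, y ≠ 0 ∧ (-(ε : ℂ) • y, y) ∈ L.1}.Finite := by
  set s := {ε : ℝ | ∃ y : Cn n, y ≠ 0 ∧ (-(ε : ℂ) • y, y) ∈ L.1}
  have hs : ∀ ε : s, ∃ y : Cn n, y ≠ 0 ∧ (-((ε : ℝ) : ℂ) • y, y) ∈ L.1 := fun ε => ε.2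
  choose y hy0 hy using hs
  have hli : LinearIndependent ℂ y := by
    refine linearIndependent_of_ne_zero_of_inner_eq_zero hy0 ?_
    intro a b hab
    have h := (L.2.mem_iff _).1 (hy b) _ (hy a)
    rw [sympForm_apply] at h
    simp only [inner_smul_left, inner_smul_right, map_neg, Complex.conj_ofReal] at h
    have h2 : (((b : ℝ) : ℂ) - ((a : ℝ) : ℂ)) * inner ℂ (y a) (y b) = 0 := by
      linear_combination h
    rcases mul_eq_zero.1 h2 with h3 | h3
    · exact absurd (Subtype.ext (by exact_mod_cast (sub_eq_zero.1 h3).symm)) hab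
    · exact h3
  have := hli.finite
  exact Set.toFinite s

/-- A Lagrangian plane transversal to the vertical plane is the graph of a Hermitian matrix. -/
theorem exists_eq_graphPlane {n : ℕ} (L : LagrangianPlane n)
    (h : ∀ y : Cn n, ((0 : Cn n), y) ∈ L.1 → y = 0) :
    ∃ (A : Matrix (Fin n) (Fin n) ℂ) (hA : A.IsHermitian), L = graphPlane A hA := by
  let p : L.1 →ₗ[ℂ] Cn n := LinearMap.fst ℂ _ _ ∘ₗ L.1.subtype
  have hinj : Function.Injective p := by
    rw [← LinearMap.ker_eq_bot, LinearMap.ker_eq_bot']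
    rintro ⟨⟨x, y⟩, hxy⟩ hx
    have hx : x = 0 := hx
    subst hx
    have := h y hxy
    subst this
    rfl
  have hsurj : Function.Surjective p := by
    rw [← LinearMap.range_eq_top, ← Submodule.orthogonal_eq_bot_iff, Submodule.eq_bot_iff]
    intro z hz
    apply h
    rw [L.2.mem_iff]
    intro u hu
    rw [sympForm_apply]
    have := (Submodule.mem_orthogonal _ _).1 hz u.1 ⟨⟨u, hu⟩, rfl⟩
    simpa using this
  let e := LinearEquiv.ofBijective p ⟨hinj, hsurj⟩
  let T : Cn n →ₗ[ℂ] Cn n := LinearMap.snd ℂ _ _ ∘ₗ L.1.subtype ∘ₗ (e.symm : Cn n →ₗ[ℂ] L.1)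
  have hT : ∀ v : Cn n × Cn n, v ∈ L.1 ↔ v.2 = T v.1 := by
    have h1 : ∀ v : L.1, T v.1.1 = v.1.2 := by
      intro v
      have : e.symm v.1.1 = v := by rw [LinearEquiv.symm_apply_eq]; rfl
      change (e.symm v.1.1).1.2 = _
      rw [this]
    intro v
    constructor
    · intro hv; exact (h1 ⟨v, hv⟩).symm
    · intro hv
      obtain ⟨w, hw⟩ := hsurj v.1
      have hw : w.1.1 = v.1 := hw
      have : v = w.1 := Prod.ext hw.symm (by rw [hv, ← hw, h1])
      rw [this]; exact w.2
  have hsymm : T.IsSymmetric := by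
    intro x y
    have := (L.2.mem_iff (y, T y)).1 ((hT _).2 rfl) (x, T x) ((hT _).2 rfl)
    rw [sympForm_apply] at this
    exact (sub_eq_zero.1 this).symm
  have hA : (Matrix.toEuclideanLin.symm T).IsHermitian := by
    rw [← Matrix.isSymmetric_toEuclideanLin_iff, LinearEquiv.apply_symm_apply]
    exact hsymm
  refine ⟨_, hA, Subtype.ext (Submodule.ext fun v => ?_)⟩
  rw [hT]
  simp only [graphPlane, LinearMap.mem_graph_iff, LinearEquiv.apply_symm_apply]

/-- Finitely many Lagrangian planes can be mapped simultaneously to graphs. -/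
theorem exists_map_eq_graphPlane {n : ℕ} {m : ℕ} (L : Fin m → LagrangianPlane n) :
    ∃ (S : (Cn n × Cn n) ≃ₗ[ℂ] (Cn n × Cn n)) (hS : IsSymplectic S), ∀ j,
      ∃ (A : Matrix (Fin n) (Fin n) ℂ) (hA : A.IsHermitian), (L j).map S hS = graphPlane A hA := by
  have hfin : (⋃ j, {ε : ℝ | ∃ y : Cn n, y ≠ 0 ∧ (-(ε : ℂ) • y, y) ∈ (L j).1}).Finite :=
    Set.finite_iUnion fun j => finite_bad_shear (L j)
  obtain ⟨ε, hε⟩ := hfin.exists_notMem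
  refine ⟨shearUp n ε, isSymplectic_shearUp n ε, fun j => exists_eq_graphPlane _ ?_⟩
  rintro y ⟨⟨a, b⟩, hab, he⟩
  rw [LinearEquiv.coe_coe, shearUp_apply] at he
  simp only [Prod.mk.injEq] at he
  obtain ⟨h1, rfl⟩ := he
  by_contra hb
  apply hε
  rw [Set.mem_iUnion]
  refine ⟨j, b, hb, ?_⟩
  rwa [show -(ε : ℂ) • b = a by rw [neg_smul]; exact (eq_neg_of_add_eq_zero_left h1).symm]

/-- A graph is parametrized by its first component. -/
noncomputable def graphEquivCn {n : ℕ} (A : Matrix (Fin n) (Fin n) ℂ) (hA : A.IsHermitian) :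
    (graphPlane A hA).1 ≃ₗ[ℂ] Cn n where
  toFun v := v.1.1
  map_add' _ _ := rfl
  map_smul' _ _ := rfl
  invFun x := ⟨(x, Matrix.toEuclideanLin A x), by
    simp only [graphPlane, LinearMap.mem_graph_iff]⟩
  left_inv v := by
    have := v.2
    simp only [graphPlane, LinearMap.mem_graph_iff] at this
    exact Subtype.ext (Prod.ext rfl this.symm)
  right_inv _ := rfl

theorem graphPlane_snd {n : ℕ} {A : Matrix (Fin n) (Fin n) ℂ} {hA : A.IsHermitian}
    (v : (graphPlane A hA).1) : v.1.2 = Matrix.toEuclideanLin A v.1.1 := by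
  have := v.2
  simpa only [graphPlane, LinearMap.mem_graph_iff] using this

/-- The vertical plane is parametrized by its second component. -/
noncomputable def verticalEquivCn (n : ℕ) : (verticalPlane n).1 ≃ₗ[ℂ] Cn n where
  toFun v := v.1.2
  map_add' _ _ := rfl
  map_smul' _ _ := rfl
  invFun x := ⟨(0, x), by simp [verticalPlane]⟩
  left_inv v := by
    have : v.1.1 = 0 := by simpa [verticalPlane] using v.2.1
    exact Subtype.ext (Prod.ext this.symm rfl)
  right_inv _ := rfl

theorem finrank_graphPlane_inf {n : ℕ} {A B : Matrix (Fin n) (Fin n) ℂ} (hA : A.IsHermitian)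
    (hB : B.IsHermitian) :
    Module.finrank ℂ ((graphPlane A hA).1 ⊓ (graphPlane B hB).1 : Submodule ℂ (Cn n × Cn n))
      = Module.finrank ℂ (Matrix.toEuclideanLin (B - A)).ker := by
  refine LinearEquiv.finrank_eq
    { toFun := fun v => ⟨v.1.1, ?_⟩
      map_add' := fun _ _ => rfl
      map_smul' := fun _ _ => rfl
      invFun := fun x => ⟨(x.1, Matrix.toEuclideanLin A x.1), ?_, ?_⟩
      left_inv := ?_
      right_inv := fun _ => rfl }
  · have h1 := graphPlane_snd ⟨v.1, v.2.1⟩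
    have h2 := graphPlane_snd ⟨v.1, v.2.2⟩
    rw [LinearMap.mem_ker, map_sub, LinearMap.sub_apply, sub_eq_zero]
    exact h2.symm.trans h1
  · simp only [graphPlane, SetLike.mem_coe, LinearMap.mem_graph_iff]
  · have : Matrix.toEuclideanLin B x.1 = Matrix.toEuclideanLin A x.1 := by
      rw [← sub_eq_zero, ← LinearMap.sub_apply, ← map_sub]
      exact x.2
    simp only [graphPlane, SetLike.mem_coe, LinearMap.mem_graph_iff]
    exact this.symm
  · intro v
    exact Subtype.ext (Prod.ext rfl (graphPlane_snd ⟨v.1, v.2.1⟩).symm)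

theorem tripleForm_apply {n : ℕ} (L₁ L₂ L₃ : Submodule ℂ (Cn n × Cn n)) (x y : L₁ × L₂ × L₃) :
    tripleForm L₁ L₂ L₃ x y = sympForm n x.1 y.2.1 + sympForm n x.2.1 y.2.2 + sympForm n x.2.2 y.1
      - sympForm n x.2.1 y.1 - sympForm n x.2.2 y.2.1 - sympForm n x.1 y.2.2 := rfl

theorem negIndex_comp {F G : Type*} [AddCommGroup F] [Module ℂ F] [AddCommGroup G] [Module ℂ G]
    (e : G ≃ₗ[ℂ] F) (q : F → ℝ) : negIndex (fun x => q (e x)) = negIndex q := by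
  unfold negIndex
  congr 1
  ext d
  constructor
  · rintro ⟨W, hd, hW⟩
    refine ⟨W.map (e : G →ₗ[ℂ] F), by rw [LinearEquiv.finrank_map_eq]; exact hd, ?_⟩
    rintro _ ⟨w, hw, rfl⟩ h0
    exact hW w hw (fun h => h0 (by simp [h]))
  · rintro ⟨W, hd, hW⟩
    refine ⟨W.map (e.symm : F →ₗ[ℂ] G), by rw [LinearEquiv.finrank_map_eq]; exact hd, ?_⟩
    rintro _ ⟨w, hw, rfl⟩ h0
    simp only [LinearEquiv.coe_coe, LinearEquiv.apply_symm_apply]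
    exact hW w hw (fun h => h0 (by simp [h]))

theorem duistermaatIndex_map {n : ℕ} (S : (Cn n × Cn n) ≃ₗ[ℂ] (Cn n × Cn n))
    (hS : IsSymplectic S) (L₁ L₂ L₃ : LagrangianPlane n) :
    duistermaatIndex (L₁.map S hS) (L₂.map S hS) (L₃.map S hS) = duistermaatIndex L₁ L₂ L₃ := by
  unfold duistermaatIndex
  congr 2
  · let e : (L₁.1 × L₂.1 × L₃.1) ≃ₗ[ℂ]
        ((L₁.map S hS).1 × (L₂.map S hS).1 × (L₃.map S hS).1) :=
      (S.submoduleMap L₁.1).prodCongr ((S.submoduleMap L₂.1).prodCongr (S.submoduleMap L₃.1))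
    rw [← negIndex_comp e]
    congr 2
    ext x
    have h1 : ((e x).1 : Cn n × Cn n) = S x.1 := rfl
    have h2 : ((e x).2.1 : Cn n × Cn n) = S x.2.1 := rfl
    have h3 : ((e x).2.2 : Cn n × Cn n) = S x.2.2 := rfl
    simp only [tripleForm_apply, h1, h2, h3, hS _ _]
  · have h : (L₁.map S hS).1 ⊓ (L₃.map S hS).1
        = (L₁.1 ⊓ L₃.1).map (S : (Cn n × Cn n) →ₗ[ℂ] (Cn n × Cn n)) :=
      (Submodule.map_inf _ S.injective).symm
    rw [h, LinearEquiv.finrank_map_eq]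

/-- The change of variables that diagonalizes the form `Ω` of three graphs. -/
noncomputable def mixEquiv (n : ℕ) : (Cn n × Cn n × Cn n) ≃ₗ[ℂ] (Cn n × Cn n × Cn n) where
  toFun v := (-v.1 + v.2.1 + v.2.2, v.1 - v.2.1 + v.2.2, v.1 + v.2.1 - v.2.2)
  map_add' a b := by
    refine Prod.ext ?_ (Prod.ext ?_ ?_) <;> simp only [Prod.fst_add, Prod.snd_add] <;> abel
  map_smul' c a := by
    refine Prod.ext ?_ (Prod.ext ?_ ?_) <;>
      simp only [Prod.smul_fst, Prod.smul_snd, RingHom.id_apply] <;> module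
  invFun w := ((2⁻¹ : ℂ) • (w.2.1 + w.2.2), (2⁻¹ : ℂ) • (w.1 + w.2.2), (2⁻¹ : ℂ) • (w.1 + w.2.1))
  left_inv v := by refine Prod.ext ?_ (Prod.ext ?_ ?_) <;> simp only <;> module
  right_inv v := by refine Prod.ext ?_ (Prod.ext ?_ ?_) <;> simp only <;> module

theorem duistermaatIndex_graph {n : ℕ} {A B C : Matrix (Fin n) (Fin n) ℂ} (hA : A.IsHermitian)
    (hB : B.IsHermitian) (hC : C.IsHermitian) :
    duistermaatIndex (graphPlane A hA) (graphPlane B hB) (graphPlane C hC)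
      = (morseIndex (hB.sub hA) : ℤ) - morseIndex (hC.sub hA) + morseIndex (hC.sub hB) := by
  have h0 : ∀ D : Matrix (Fin n) (Fin n) ℂ, matQuad D 0 = 0 := matQuad_zero
  have hneg : HasNegIndex
      (fun x => (tripleForm (graphPlane A hA).1 (graphPlane B hB).1 (graphPlane C hC).1 x x).re)
      (morseIndex (hC.sub hB) + (morseIndex (hA.sub hC) + morseIndex (hB.sub hA))) := by
    refine HasNegIndex.comp
      (HasNegIndex.prod (hasNegIndex_matQuad (hC.sub hB))
        (HasNegIndex.prod (hasNegIndex_matQuad (hA.sub hC)) (hasNegIndex_matQuad (hB.sub hA))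
          (h0 _) (h0 _)) (h0 _) (by simp [h0]))
      (((graphEquivCn A hA).prodCongr ((graphEquivCn B hB).prodCongr (graphEquivCn C hC))).trans
        (mixEquiv n)) (c := 1 / 2) (by norm_num) ?_
    rintro ⟨u, v, w⟩
    have hu := graphPlane_snd u
    have hv := graphPlane_snd v
    have hw := graphPlane_snd w
    have he : ((((graphEquivCn A hA).prodCongr
        ((graphEquivCn B hB).prodCongr (graphEquivCn C hC))).trans (mixEquiv n)) (u, v, w))
        = (-u.1.1 + v.1.1 + w.1.1, u.1.1 - v.1.1 + w.1.1, u.1.1 + v.1.1 - w.1.1) := rfl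
    rw [he]
    simp only [matQuad, tripleForm_apply, sympForm_apply, hu, hv, hw]
    generalize u.1.1 = x
    generalize v.1.1 = y
    generalize w.1.1 = z
    rw [← Complex.add_re, ← Complex.add_re,
      show (1 / 2 : ℝ) = ((1 / 2 : ℝ) : ℂ).re from rfl]
    rw [show ∀ t : ℂ, ((1 / 2 : ℝ) : ℂ).re * t.re = (((1 / 2 : ℝ) : ℂ) * t).re from
      fun t => by rw [Complex.re_ofReal_mul, Complex.ofReal_re]]
    congr 1
    simp only [map_sub, map_add, map_neg, LinearMap.sub_apply, inner_add_left, inner_add_right,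
      inner_sub_left, inner_sub_right, inner_neg_left, inner_neg_right,
      inner_toEuclideanLin hA, inner_toEuclideanLin hB, inner_toEuclideanLin hC]
    push_cast
    ring
  have hk := morseIndex_neg (hC.sub hA) (by simpa using hA.sub hC)
  have hswap : ∀ h, morseIndex (A := -(C - A)) h = morseIndex (hA.sub hC) := by
    rw [neg_sub]; intro h; rfl
  rw [hswap] at hk
  unfold duistermaatIndex
  rw [hneg.negIndex_eq, finrank_graphPlane_inf]
  push_cast
  have hk' : (morseIndex (hA.sub hC) : ℤ) + morseIndex (hC.sub hA)
    + Module.finrank ℂ (Matrix.toEuclideanLin (C - A)).ker = n := by exact_mod_cast hk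
  linarith

/-- The hyperbolic form `Re ⟨u, w⟩` on `ℂⁿ ⊕ ℂⁿ` has negative index `n`. -/
theorem hasNegIndex_hyperbolic (n : ℕ) :
    HasNegIndex (fun v : Cn n × Cn n => (inner ℂ v.1 v.2).re) n := by
  have hfr : ∀ f : Cn n →ₗ[ℂ] Cn n, Module.finrank ℂ f.graph = n := by
    intro f
    have : Module.finrank ℂ f.graph = Module.finrank ℂ (Cn n) :=
      LinearEquiv.finrank_eq
        { toFun := fun v => v.1.1
          map_add' := fun _ _ => rfl
          map_smul' := fun _ _ => rfl
          invFun := fun x => ⟨(x, f x), by rw [LinearMap.mem_graph_iff]⟩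
          left_inv := fun v => Subtype.ext (Prod.ext rfl ((LinearMap.mem_graph_iff _ _).1 v.2).symm)
          right_inv := fun _ => rfl }
    simpa using this
  refine ⟨(-LinearMap.id : Cn n →ₗ[ℂ] Cn n).graph, (LinearMap.id : Cn n →ₗ[ℂ] Cn n).graph,
    ?_, ?_, hfr _, by rw [hfr, hfr, Module.finrank_prod]; simp⟩
  · rintro ⟨x, y⟩ hxy h0
    have hy : y = -x := (LinearMap.mem_graph_iff _ _).1 hxy
    subst hy
    have hx : x ≠ 0 := by rintro rfl; simp at h0
    have hpos : 0 < ‖x‖ ^ 2 := by positivity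
    have h2 : (inner ℂ x x).re = ‖x‖ ^ 2 := inner_self_eq_norm_sq (𝕜 := ℂ) x
    simp only [inner_neg_right, Complex.neg_re]
    linarith
  · rintro ⟨x, y⟩ hxy
    have hy : y = x := (LinearMap.mem_graph_iff _ _).1 hxy
    subst hy
    exact inner_self_nonneg (𝕜 := ℂ)

/-- The change of variables `(x, y, z) ↦ (x, y - x, z + A x)`. -/
noncomputable def normEquiv {n : ℕ} (A : Matrix (Fin n) (Fin n) ℂ) :
    (Cn n × Cn n × Cn n) ≃ₗ[ℂ] (Cn n × Cn n × Cn n) where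
  toFun v := (v.1, v.2.1 - v.1, v.2.2 + Matrix.toEuclideanLin A v.1)
  map_add' a b := by
    refine Prod.ext rfl (Prod.ext ?_ ?_) <;>
      simp only [Prod.fst_add, Prod.snd_add, map_add] <;> abel
  map_smul' c a := by
    refine Prod.ext rfl (Prod.ext ?_ ?_) <;>
      simp only [Prod.smul_fst, Prod.smul_snd, RingHom.id_apply, map_smul] <;> module
  invFun w := (w.1, w.2.1 + w.1, w.2.2 - Matrix.toEuclideanLin A w.1)
  left_inv v := by simp
  right_inv v := by simp

theorem duistermaatIndex_normalization {n : ℕ} (A : Matrix (Fin n) (Fin n) ℂ)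
    (hA : A.IsHermitian) :
    duistermaatIndex (graphPlane 0 Matrix.isHermitian_zero) (graphPlane A hA) (verticalPlane n)
      = morseIndex hA := by
  have hneg : HasNegIndex
      (fun x => (tripleForm (graphPlane (0 : Matrix (Fin n) (Fin n) ℂ) Matrix.isHermitian_zero).1
        (graphPlane A hA).1 (verticalPlane n).1 x x).re) (morseIndex hA + n) := by
    refine HasNegIndex.comp
      (HasNegIndex.prod (hasNegIndex_matQuad hA) (hasNegIndex_hyperbolic n)
        (matQuad_zero A) (by simp))
      (((graphEquivCn 0 Matrix.isHermitian_zero).prodCongr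
        ((graphEquivCn A hA).prodCongr (verticalEquivCn n))).trans (normEquiv A))
      (c := 2) (by norm_num) ?_
    rintro ⟨u, v, w⟩
    have hu := graphPlane_snd u
    have hv := graphPlane_snd v
    have hw : w.1.1 = 0 := by simpa [verticalPlane] using w.2.1
    have he : ((((graphEquivCn 0 Matrix.isHermitian_zero).prodCongr
        ((graphEquivCn A hA).prodCongr (verticalEquivCn n))).trans (normEquiv A)) (u, v, w))
        = (u.1.1, v.1.1 - u.1.1, w.1.2 + Matrix.toEuclideanLin A u.1.1) := rfl
    rw [he]
    simp only [matQuad, tripleForm_apply, sympForm_apply, hu, hv, hw]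
    generalize u.1.1 = x
    generalize v.1.1 = y
    generalize w.1.2 = z
    have e1 : (inner ℂ z x).re = (inner ℂ x z).re := inner_re_symm (𝕜 := ℂ) z x
    have e2 : (inner ℂ z y).re = (inner ℂ y z).re := inner_re_symm (𝕜 := ℂ) z y
    have e3 : (inner ℂ y (Matrix.toEuclideanLin A x)).re
        = (inner ℂ x (Matrix.toEuclideanLin A y)).re := by
      rw [← inner_toEuclideanLin hA]
      exact inner_re_symm (𝕜 := ℂ) _ _
    simp only [map_zero, LinearMap.zero_apply, inner_zero_left, inner_zero_right, inner_add_right,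
      inner_sub_left, inner_toEuclideanLin hA, Complex.add_re, Complex.sub_re, Complex.zero_re]
    linarith
  have hinf : ((graphPlane (0 : Matrix (Fin n) (Fin n) ℂ) Matrix.isHermitian_zero).1
      ⊓ (verticalPlane n).1) = ⊥ := by
    rw [Submodule.eq_bot_iff]
    intro v hv
    have h1 := graphPlane_snd ⟨v, hv.1⟩
    have h2 : v.1 = 0 := by simpa [verticalPlane] using hv.2.1
    refine Prod.ext h2 ?_
    simpa using h1
  unfold duistermaatIndex
  rw [hneg.negIndex_eq, hinf]
  simp

theorem isDuistermaatIndex_duistermaatIndex (n : ℕ) :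
    IsDuistermaatIndex (duistermaatIndex (n := n)) where
  normalization := duistermaatIndex_normalization
  invariance := duistermaatIndex_map
  cocycle L₁ L₂ L₃ L₄ := by
    obtain ⟨S, hS, h⟩ := exists_map_eq_graphPlane ![L₁, L₂, L₃, L₄]
    obtain ⟨A₁, h₁, e₁⟩ := h 0
    obtain ⟨A₂, h₂, e₂⟩ := h 1
    obtain ⟨A₃, h₃, e₃⟩ := h 2
    obtain ⟨A₄, h₄, e₄⟩ := h 3
    have e₁ : L₁.map S hS = _ := e₁
    have e₂ : L₂.map S hS = _ := e₂
    have e₃ : L₃.map S hS = _ := e₃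
    have e₄ : L₄.map S hS = _ := e₄
    rw [← duistermaatIndex_map S hS L₁ L₂ L₃, ← duistermaatIndex_map S hS L₁ L₂ L₄,
      ← duistermaatIndex_map S hS L₁ L₃ L₄, ← duistermaatIndex_map S hS L₂ L₃ L₄, e₁, e₂, e₃, e₄]
    simp only [duistermaatIndex_graph]
    ring

theorem map_shearDown_graphPlane {n : ℕ} {A B : Matrix (Fin n) (Fin n) ℂ} (hA : A.IsHermitian)
    (hB : B.IsHermitian) :
    (graphPlane B hB).map (shearDown A) (isSymplectic_shearDown hA)
      = graphPlane (B + A) (hB.add hA) := by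
  refine Subtype.ext (Submodule.ext fun v => ?_)
  simp only [LagrangianPlane.map, graphPlane, Submodule.mem_map, LinearMap.mem_graph_iff,
    LinearEquiv.coe_coe, shearDown_apply, map_add, LinearMap.add_apply]
  constructor
  · rintro ⟨w, hw, rfl⟩
    simp only [hw]
  · intro h
    exact ⟨(v.1, Matrix.toEuclideanLin B v.1), rfl, Prod.ext rfl h.symm⟩

theorem map_shearDown_verticalPlane {n : ℕ} {A : Matrix (Fin n) (Fin n) ℂ} (hA : A.IsHermitian) :
    (verticalPlane n).map (shearDown A) (isSymplectic_shearDown hA) = verticalPlane n := by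
  refine Subtype.ext (Submodule.ext fun v => ?_)
  simp only [LagrangianPlane.map, verticalPlane, Submodule.mem_map, Submodule.mem_prod,
    Submodule.mem_bot, Submodule.mem_top, and_true, LinearEquiv.coe_coe, shearDown_apply]
  constructor
  · rintro ⟨w, hw, rfl⟩
    exact hw
  · intro h
    exact ⟨v, h, Prod.ext rfl (by simp [h])⟩

theorem IsDuistermaatIndex.graph_vertical {n : ℕ}
    {i : LagrangianPlane n → LagrangianPlane n → LagrangianPlane n → ℤ}
    (hi : IsDuistermaatIndex i) {A B : Matrix (Fin n) (Fin n) ℂ} (hA : A.IsHermitian)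
    (hB : B.IsHermitian) :
    i (graphPlane A hA) (graphPlane B hB) (verticalPlane n) = morseIndex (hB.sub hA) := by
  have h := hi.invariance (shearDown A) (isSymplectic_shearDown hA)
    (graphPlane 0 Matrix.isHermitian_zero) (graphPlane (B - A) (hB.sub hA)) (verticalPlane n)
  rw [hi.normalization, map_shearDown_verticalPlane hA,
    map_shearDown_graphPlane hA Matrix.isHermitian_zero,
    map_shearDown_graphPlane hA (hB.sub hA)] at h
  simpa only [zero_add, sub_add_cancel] using h

/-- The axioms determine the Duistermaat index. -/
theorem IsDuistermaatIndex.eq {n : ℕ}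
    {i : LagrangianPlane n → LagrangianPlane n → LagrangianPlane n → ℤ}
    (hi : IsDuistermaatIndex i) : i = duistermaatIndex := by
  funext L₁ L₂ L₃
  obtain ⟨S, hS, h⟩ := exists_map_eq_graphPlane ![L₁, L₂, L₃]
  obtain ⟨A₁, h₁, e₁⟩ := h 0
  obtain ⟨A₂, h₂, e₂⟩ := h 1
  obtain ⟨A₃, h₃, e₃⟩ := h 2
  have e₁ : L₁.map S hS = _ := e₁
  have e₂ : L₂.map S hS = _ := e₂
  have e₃ : L₃.map S hS = _ := e₃
  have hc := hi.cocycle (graphPlane A₁ h₁) (graphPlane A₂ h₂) (graphPlane A₃ h₃) (verticalPlane n)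
  rw [hi.graph_vertical, hi.graph_vertical, hi.graph_vertical] at hc
  rw [← hi.invariance S hS, ← duistermaatIndex_map S hS, e₁, e₂, e₃, duistermaatIndex_graph]
  linarith

/-! The ambient space splits into `n` pairwise ω-orthogonal hyperbolic planes such that each
Lagrangian plane of the triple is the direct sum of its lines in them. In a two-dimensional space a
triple of Lagrangian lines has six normal forms: all equal, exactly one of the three lines different
from the other two (three forms), or all distinct (two forms, told apart by a sign that no
symplectic map can change). So a triple is determined up to symplectic equivalence by the six
multiplicities of these forms.

The splitting is found one plane at a time. `exists_darboux_pair` finds a hyperbolic plane that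
meets all three subspaces in lines of a normal form, and `IsAdaptedFrame.exists_extend` applies it
in the symplectic complement of the planes already found, where the traces of the `L j` are again
Lagrangian. A complete frame carries a model triple of diagonal graphs to the given one
(`IsAdaptedFrame.exists_symplectic`).

On the model every invariant is a sum of multiplicities `c τ`: the total is `n`, the pairwise
intersections give `c 0 + c 1`, `c 0 + c 2`, `c 0 + c 3`, the triple intersection gives `c 0`, and
the index gives `c 2 + c 5`. These six linear equations determine all six multiplicities.
Conversely, all the invariants are preserved by symplectic maps. -/

open scoped ComplexConjugate

/-! ### Lagrangian triples in a skew-Hermitian space -/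

/-- Slopes, in a Darboux basis of a plane, of the six normal forms of a triple of lines. -/
def lineSlope (j : Fin 3) (τ : Fin 6) : ℤ :=
  ![![0, 0, 0, 1, 0, 0], ![0, 0, 1, 0, 1, -1], ![0, 1, 0, 0, 2, -2]] j τ

section SkewHermitian

variable {V : Type*} [AddCommGroup V] [Module ℂ V] {ω : V →ₗ⋆[ℂ] V →ₗ[ℂ] ℂ}

/-- A subspace with trivial orthogonal complement is the whole space. -/
theorem eq_top_of_forall_orthogonal_eq_zero [FiniteDimensional ℂ V] {W : Submodule ℂ V}
    (h : ∀ v, (∀ u ∈ W, ω u v = 0) → v = 0) : W = ⊤ := by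
  let b := Module.finBasis ℂ W
  -- Pairing with a basis of `W` has the orthogonal complement of `W` as its kernel, so its
  -- injectivity gives `dim V ≤ dim W`.
  let φ : V →ₗ[ℂ] (Fin (Module.finrank ℂ W) → ℂ) := LinearMap.pi fun i => ω (b i)
  have hφ : Function.Injective φ := by
    rw [← LinearMap.ker_eq_bot, LinearMap.ker_eq_bot']
    intro v hv
    refine h v fun u hu => ?_
    have hu' := b.sum_repr ⟨u, hu⟩
    have : u = ∑ i, b.repr ⟨u, hu⟩ i • (b i : V) := by
      have h' := congrArg W.subtype hu'
      simp only [map_sum, map_smul, Submodule.subtype_apply] at h'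
      exact h'.symm
    rw [this, map_sum, LinearMap.sum_apply]
    refine Finset.sum_eq_zero fun i _ => ?_
    have hi : ω (b i) v = 0 := congrFun hv i
    rw [LinearMap.map_smulₛₗ, LinearMap.smul_apply, hi, smul_zero]
  refine Submodule.eq_top_of_finrank_eq (le_antisymm (Submodule.finrank_le W) ?_)
  simpa using LinearMap.finrank_le_finrank_of_injective hφ

theorem exists_mem_form_eq_one (hskew : ∀ x y, ω y x = -conj (ω x y)) {W : Submodule ℂ V} {x : V}
    (h : ¬ ∀ u ∈ W, ω u x = 0) : ∃ z ∈ W, ω x z = 1 := by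
  push Not at h
  obtain ⟨u, hu, hux⟩ := h
  have hxu : ω x u ≠ 0 := by
    rw [hskew u x]
    simpa using hux
  exact ⟨(ω x u)⁻¹ • u, W.smul_mem _ hu, by simp [hxu]⟩

/-- If `x` and `z` are isotropic and dual to each other then `x`, `z - x` is a Darboux pair. -/
theorem darboux_sub (hskew : ∀ x y, ω y x = -conj (ω x y)) {x z : V} (hx : ω x x = 0)
    (hz : ω z z = 0) (hxz : ω x z = 1) : ω (z - x) (z - x) = 0 ∧ ω x (z - x) = 1 := by
  have hzx : ω z x = -1 := by rw [hskew, hxz]; simp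
  simp [hx, hz, hxz, hzx]

/-- The second vector of a dual pair can be corrected to be isotropic. -/
theorem exists_isotropic_dual (hskew : ∀ x y, ω y x = -conj (ω x y)) {x z : V} (hx : ω x x = 0)
    (hxz : ω x z = 1) : ∃ f, ω f f = 0 ∧ ω x f = 1 := by
  have hzx : ω z x = -1 := by rw [hskew, hxz]; simp
  have hw : conj (ω z z) = -ω z z := by
    rw [eq_neg_iff_add_eq_zero, add_comm, ← eq_neg_iff_add_eq_zero]
    exact hskew z z
  -- Adding `c • x` changes `ω z z` by `conj c - c`. Since `ω z z` is purely imaginary, `c = ω z z /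
  -- 2` cancels it.
  refine ⟨z + (ω z z / 2) • x, ?_, by simp [hx, hxz]⟩
  simp only [map_add, LinearMap.add_apply, LinearMap.map_smulₛₗ, LinearMap.smul_apply, hx, hxz,
    hzx, smul_eq_mul, map_div₀, hw, RingHom.id_apply, Complex.conj_ofNat]
  ring

/-- For three pairwise transversal Lagrangian subspaces, some vector of the middle one has
components in the outer two that are not orthogonal to each other. -/
theorem exists_nonorthogonal_components [FiniteDimensional ℂ V] [Nontrivial V]
    {L₀ L₁ L₂ : Submodule ℂ V} (h₀ : ∀ v, v ∈ L₀ ↔ ∀ u ∈ L₀, ω u v = 0)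
    (h₁ : ∀ v, v ∈ L₁ ↔ ∀ u ∈ L₁, ω u v = 0) (h₂ : ∀ v, v ∈ L₂ ↔ ∀ u ∈ L₂, ω u v = 0)
    (h₀₁ : ∀ v ∈ L₀, v ∈ L₁ → v = 0) (h₀₂ : ∀ v ∈ L₀, v ∈ L₂ → v = 0)
    (h₁₂ : ∀ v ∈ L₁, v ∈ L₂ → v = 0) :
    ∃ x ∈ L₀, ∃ z ∈ L₂, x + z ∈ L₁ ∧ ω x z ≠ 0 := by
  by_contra! hc
  have htop : L₀ ⊔ L₂ = ⊤ := by
    refine eq_top_of_forall_orthogonal_eq_zero (ω := ω) fun v hv => h₀₂ v ?_ ?_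
    · exact (h₀ v).2 fun u hu => hv u (Submodule.mem_sup_left hu)
    · exact (h₂ v).2 fun u hu => hv u (Submodule.mem_sup_right hu)
  -- Polarization of the form `ω x z` on `L₁`: its vanishing on the sums with coefficients `1` and
  -- `I` isolates the mixed term.
  have hpol : ∀ x ∈ L₀, ∀ z ∈ L₂, x + z ∈ L₁ → ∀ x' ∈ L₀, ∀ z' ∈ L₂, x' + z' ∈ L₁ →
      ω x' z = 0 := by
    intro x hx z hz hxz x' hx' z' hz' hxz'
    have e0 := hc x hx z hz hxz
    have e0' := hc x' hx' z' hz' hxz'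
    have e1 := hc (x + x') (add_mem hx hx') (z + z') (add_mem hz hz')
      (by rw [add_add_add_comm]; exact add_mem hxz hxz')
    have e2 := hc (x + Complex.I • x') (add_mem hx (L₀.smul_mem _ hx')) (z + Complex.I • z')
      (add_mem hz (L₂.smul_mem _ hz'))
      (by rw [add_add_add_comm, ← smul_add]; exact add_mem hxz (L₁.smul_mem _ hxz'))
    simp only [map_add, LinearMap.add_apply, LinearMap.map_smulₛₗ, LinearMap.smul_apply,
      smul_eq_mul, RingHom.id_apply, Complex.conj_I, e0, e0'] at e1 e2
    have hI0 := Complex.I_ne_zero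
    have : 2 * Complex.I * ω x' z = 0 := by linear_combination Complex.I * e1 - e2
    simpa [hI0] using this
  obtain ⟨v, hv⟩ := exists_ne (0 : V)
  have hbot : ∀ y ∈ L₁, y = 0 := by
    intro y hy
    obtain ⟨x, hx, z, hz, rfl⟩ := Submodule.mem_sup.1 (htop ▸ Submodule.mem_top : y ∈ L₀ ⊔ L₂)
    -- By polarization `z` is orthogonal to the `L₀`-components of `L₁`, and to their
    -- `L₂`-components because `L₂` is isotropic. Hence `z` lies in the complement of `L₁`, which is
    -- `L₁`, and transversality makes first `z` and then `x` vanish.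
    have hz1 : z ∈ L₁ := by
      refine (h₁ z).2 fun u hu => ?_
      obtain ⟨x', hx', z', hz', rfl⟩ :=
        Submodule.mem_sup.1 (htop ▸ Submodule.mem_top : u ∈ L₀ ⊔ L₂)
      rw [map_add, LinearMap.add_apply, hpol x hx z hz hy x' hx' z' hz' hu, (h₂ z).1 hz z' hz',
        add_zero]
    have hz0 := h₁₂ z hz1 hz
    subst hz0
    rw [add_zero] at hy ⊢
    exact h₀₁ x hx hy
  -- If `L₁` is zero, its complement is all of `V`, contradicting nontriviality.
  refine hv (hbot v ((h₁ v).2 fun u hu => ?_))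
  rw [hbot u hu]
  simp

/-- Three Lagrangian subspaces of a nonzero skew-Hermitian space meet a common hyperbolic plane
in one of the normal forms. -/
theorem exists_darboux_pair [FiniteDimensional ℂ V] [Nontrivial V]
    (hskew : ∀ x y, ω y x = -conj (ω x y)) (hnd : ∀ v, (∀ u, ω u v = 0) → v = 0)
    (L : Fin 3 → Submodule ℂ V) (hL : ∀ j v, v ∈ L j ↔ ∀ u ∈ L j, ω u v = 0) :
    ∃ e f τ, ω e e = 0 ∧ ω f f = 0 ∧ ω e f = 1 ∧ ∀ j, e + (lineSlope j τ : ℂ) • f ∈ L j := by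
  have hiso : ∀ j, ∀ x ∈ L j, ω x x = 0 := fun j x hx => (hL j x).1 hx x hx
  -- As `L l` is its own complement, `x ∉ L l` has a dual vector `z` in `L l`. Taking `f = z - x`
  -- places `L l` at slope `1`.
  have pair : ∀ l x, ω x x = 0 → x ∉ L l →
      ∃ f, ω f f = 0 ∧ ω x f = 1 ∧ x + f ∈ L l := by
    intro l x hx hxl
    obtain ⟨z, hz, hxz⟩ := exists_mem_form_eq_one hskew (fun h => hxl ((hL l x).2 h))
    obtain ⟨h1, h2⟩ := darboux_sub hskew hx (hiso l z hz) hxz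
    exact ⟨z - x, h1, h2, by simpa using hz⟩
  by_cases h01 : ∃ x ∈ L 0, x ∈ L 1 ∧ x ∉ L 2
  · obtain ⟨x, h0, h1, h2⟩ := h01
    obtain ⟨f, hf, hxf, hm⟩ := pair 2 x (hiso 0 x h0) h2
    refine ⟨x, f, 1, hiso 0 x h0, hf, hxf, ?_⟩
    simpa [Fin.forall_fin_succ, lineSlope] using ⟨h0, h1, hm⟩
  by_cases h02 : ∃ x ∈ L 0, x ∈ L 2 ∧ x ∉ L 1
  · obtain ⟨x, h0, h2, h1⟩ := h02
    obtain ⟨f, hf, hxf, hm⟩ := pair 1 x (hiso 0 x h0) h1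
    refine ⟨x, f, 2, hiso 0 x h0, hf, hxf, ?_⟩
    simpa [Fin.forall_fin_succ, lineSlope] using ⟨h0, hm, h2⟩
  by_cases h12 : ∃ x ∈ L 1, x ∈ L 2 ∧ x ∉ L 0
  · obtain ⟨x, h1, h2, h0⟩ := h12
    obtain ⟨f, hf, hxf, hm⟩ := pair 0 x (hiso 1 x h1) h0
    refine ⟨x, f, 3, hiso 1 x h1, hf, hxf, ?_⟩
    simpa [Fin.forall_fin_succ, lineSlope] using ⟨hm, h1, h2⟩
  -- From here on, a vector common to two of the subspaces lies in all three.
  push Not at h01 h02 h12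
  by_cases h012 : ∃ x, x ≠ 0 ∧ ∀ j, x ∈ L j
  · obtain ⟨x, hx0, hx⟩ := h012
    obtain ⟨z, -, hxz⟩ := exists_mem_form_eq_one (W := ⊤) hskew
      (fun h => hx0 (hnd x fun u => h u Submodule.mem_top))
    obtain ⟨f, hf, hxf⟩ := exists_isotropic_dual hskew (hiso 0 x (hx 0)) hxz
    refine ⟨x, f, 0, hiso 0 x (hx 0), hf, hxf, ?_⟩
    simpa [Fin.forall_fin_succ, lineSlope] using ⟨hx 0, hx 1, hx 2⟩
  push Not at h012
  have htriv : ∀ x, x ∈ L 0 → x ∈ L 1 → x ∈ L 2 → x = 0 := by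
    intro x h0 h1 h2
    by_contra hx
    obtain ⟨j, hj⟩ := h012 x hx
    fin_cases j
    exacts [hj h0, hj h1, hj h2]
  obtain ⟨x, hx, z, hz, hxz, hq⟩ := exists_nonorthogonal_components (hL 0) (hL 1) (hL 2)
    (fun v h0 h1 => htriv v h0 h1 (h01 v h0 h1)) (fun v h0 h2 => htriv v h0 (h02 v h0 h2) h2)
    (fun v h1 h2 => htriv v (h12 v h1 h2) h1 h2)
  have hx0 := hiso 0 x hx
  have hz0 := hiso 2 z hz
  have hy0 := hiso 1 _ hxz
  simp only [map_add, LinearMap.add_apply, hx0, hz0, zero_add, add_zero] at hy0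
  -- Isotropy of `x`, `z` and `x + z` together with skew-Hermitian symmetry makes `ω x z` real, so
  -- it has a sign.
  have hzx : ω z x = -ω x z := by linear_combination hy0
  have hreal : conj (ω x z) = ω x z := by
    have := hskew x z
    rw [hzx] at this
    linear_combination this
  obtain ⟨q, hq'⟩ := Complex.conj_eq_iff_real.1 hreal
  rw [hq'] at hq hzx
  have hq0 : q ≠ 0 := by simpa using hq
  -- the pair `x, z` rescaled so that its product is `2 s` with `s = ±1`
  have key : ∀ s : ℝ, s * s = 1 → 0 < q * s →
      ∃ e f, ω e e = 0 ∧ ω f f = 0 ∧ ω e f = 1 ∧ e ∈ L 0 ∧ e + (s : ℂ) • f ∈ L 1 ∧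
        e + (2 * s : ℂ) • f ∈ L 2 := by
    intro s hs hqs
    -- Replacing `x`, `z` by `c • x`, `c • z` multiplies `q` by `c ^ 2`, so only the modulus of `q`
    -- can be normalized. The factor `s / 2` in `f` is chosen so that `e + s • f` and `e + 2 s • f`
    -- are `(c / 2) • (x + z)` and `c • z`.
    set c : ℝ := √(2 / (q * s)) with hc
    have hcc : c * c * q = 2 * s := by
      rw [hc, Real.mul_self_sqrt (by positivity)]
      have hs0 : s ≠ 0 := by rintro rfl; simp at hs
      field_simp
      linear_combination -hs
    have hcc' : (c : ℂ) * c * q = 2 * s := by exact_mod_cast hcc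
    have hs' : (s : ℂ) * s = 1 := by exact_mod_cast hs
    refine ⟨(c : ℂ) • x, (s / 2 * c : ℂ) • (z - x), ?_, ?_, ?_, (L 0).smul_mem _ hx, ?_, ?_⟩
    · simp only [LinearMap.map_smulₛₗ, LinearMap.smul_apply, hx0, smul_zero]
    · simp [hx0, hz0, hq', hzx]
    · simp only [map_sub, LinearMap.map_smulₛₗ, LinearMap.smul_apply, hx0, hq', smul_eq_mul,
        Complex.conj_ofReal, RingHom.id_apply]
      linear_combination (s / 2 : ℂ) * hcc' + hs'
    · have : (c : ℂ) • x + (s : ℂ) • (s / 2 * c : ℂ) • (z - x) = (c / 2 : ℂ) • (x + z) := by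
        rw [smul_smul, show (s : ℂ) * (s / 2 * c) = c / 2 by linear_combination (c / 2 : ℂ) * hs']
        module
      rw [this]
      exact (L 1).smul_mem _ hxz
    · have : (c : ℂ) • x + (2 * s : ℂ) • (s / 2 * c : ℂ) • (z - x) = (c : ℂ) • z := by
        rw [smul_smul, show (2 * s : ℂ) * (s / 2 * c) = c by linear_combination (c : ℂ) * hs']
        module
      rw [this]
      exact (L 2).smul_mem _ hz
  -- The sign of `q` separates the two normal forms of three distinct lines.
  rcases lt_or_gt_of_ne hq0 with hneg | hpos
  · obtain ⟨e, f, h1, h2, h3, h4, h5, h6⟩ := key (-1) (by norm_num) (by linarith)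
    refine ⟨e, f, 5, h1, h2, h3, ?_⟩
    norm_num at h5 h6
    simpa [Fin.forall_fin_succ, lineSlope] using ⟨h4, h5, h6⟩
  · obtain ⟨e, f, h1, h2, h3, h4, h5, h6⟩ := key 1 (by norm_num) (by linarith)
    refine ⟨e, f, 4, h1, h2, h3, ?_⟩
    norm_num at h5 h6
    simpa [Fin.forall_fin_succ, lineSlope] using ⟨h4, h5, h6⟩

end SkewHermitian

/-! ### Darboux frames adapted to a triple of Lagrangian planes -/

theorem sympForm_skew {n : ℕ} (x y : Cn n × Cn n) :
    sympForm n y x = -conj (sympForm n x y) := by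
  simp only [sympForm_apply, map_sub, inner_conj_symm]
  ring

theorem sympForm_nondegenerate {n : ℕ} {v : Cn n × Cn n} (h : ∀ u, sympForm n u v = 0) :
    v = 0 := by
  have h1 := h (0, v.1)
  have h2 := h (v.2, 0)
  simp only [sympForm_apply, inner_zero_left, zero_sub, sub_zero, neg_eq_zero,
    inner_self_eq_zero] at h1 h2
  exact Prod.ext h1 h2

/-- A Darboux family whose planes meet the Lagrangian planes `L j` in the normal forms prescribed
by `t`. -/
structure IsAdaptedFrame {n k : ℕ} (L : Fin 3 → LagrangianPlane n) (e f : Fin k → Cn n × Cn n)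
    (t : Fin k → Fin 6) : Prop where
  form_left : ∀ i j, sympForm n (e i) (e j) = 0
  form_right : ∀ i j, sympForm n (f i) (f j) = 0
  form_left_right : ∀ i j, sympForm n (e i) (f j) = if i = j then 1 else 0
  mem : ∀ j i, e i + (lineSlope j (t i) : ℂ) • f i ∈ (L j).1

/-! ### Extending an adapted frame by a hyperbolic plane -/

namespace IsAdaptedFrame

variable {n k : ℕ} {L : Fin 3 → LagrangianPlane n} {e f : Fin k → Cn n × Cn n} {t : Fin k → Fin 6}

theorem form_right_left (h : IsAdaptedFrame L e f t) (i j : Fin k) :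
    sympForm n (f i) (e j) = if i = j then -1 else 0 := by
  rw [sympForm_skew, h.form_left_right]
  by_cases hij : i = j <;> simp [hij, eq_comm]

theorem reindex (h : IsAdaptedFrame L e f t) (σ : Equiv.Perm (Fin k)) :
    IsAdaptedFrame L (e ∘ σ) (f ∘ σ) (t ∘ σ) where
  form_left i j := h.form_left _ _
  form_right i j := h.form_right _ _
  form_left_right i j := by simp [h.form_left_right]
  mem j i := h.mem _ _

/-- The symplectic complement of the span of a frame. -/
noncomputable def complement (e f : Fin k → Cn n × Cn n) : Submodule ℂ (Cn n × Cn n) :=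
  LinearMap.ker (LinearMap.pi fun i => (sympForm n (e i)).prod (sympForm n (f i)))

theorem mem_complement {v : Cn n × Cn n} :
    v ∈ complement e f ↔ ∀ i, sympForm n (e i) v = 0 ∧ sympForm n (f i) v = 0 := by
  simp [complement, LinearMap.mem_ker, funext_iff]

theorem complement_ne_bot (hk : k < n) (e f : Fin k → Cn n × Cn n) : complement e f ≠ ⊥ := by
  intro h
  -- The complement is the common kernel of `2 * k` functionals on a space of dimension `2 * n`.
  have := LinearMap.finrank_le_finrank_of_injective (LinearMap.ker_eq_bot.1 h)
  rw [Module.finrank_pi_fintype] at this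
  simp at this
  omega

/-- The symplectic projection onto the complement of a frame. -/
noncomputable def proj (e f : Fin k → Cn n × Cn n) (v : Cn n × Cn n) : Cn n × Cn n :=
  v + ∑ i, (sympForm n (f i) v • e i - sympForm n (e i) v • f i)

theorem proj_mem (h : IsAdaptedFrame L e f t) (v : Cn n × Cn n) : proj e f v ∈ complement e f := by
  rw [mem_complement]
  intro i
  simp [proj, h.form_left, h.form_right, h.form_left_right, h.form_right_left]

/-- Since `v` is orthogonal to `e i + s • f i` with `s` the slope, each correction term is a
multiple of that vector, which itself lies in `L j`. -/
theorem proj_mem_plane (h : IsAdaptedFrame L e f t) (j : Fin 3) {v : Cn n × Cn n}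
    (hv : v ∈ (L j).1) : proj e f v ∈ (L j).1 := by
  refine add_mem hv (sum_mem fun i _ => ?_)
  have h1 := ((L j).2.mem_iff v).1 hv _ (h.mem j i)
  simp only [map_add, LinearMap.add_apply, LinearMap.map_smulₛₗ, LinearMap.smul_apply,
    smul_eq_mul, map_intCast] at h1
  have h2 : sympForm n (e i) v = -(lineSlope j (t i) * sympForm n (f i) v) := by
    linear_combination h1
  have h3 : sympForm n (f i) v • e i - sympForm n (e i) v • f i
      = sympForm n (f i) v • (e i + (lineSlope j (t i) : ℂ) • f i) := by
    rw [h2]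
    module
  rw [h3]
  exact Submodule.smul_mem _ _ (h.mem j i)

/-- Orthogonality to vectors of the complement may thus be tested on projections only. This is how
nondegeneracy and the Lagrangian property pass to the complement. -/
theorem form_proj {v w : Cn n × Cn n} (hv : v ∈ complement e f) :
    sympForm n (proj e f w) v = sympForm n w v := by
  rw [mem_complement] at hv
  simp [proj, hv]

theorem exists_extend (h : IsAdaptedFrame L e f t) (hk : k < n) :
    ∃ (e' f' : Fin (k + 1) → Cn n × Cn n) (t' : Fin (k + 1) → Fin 6),
      IsAdaptedFrame L e' f' t' := by
  set U := complement e f with hU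
  have : Nontrivial U := Submodule.nontrivial_iff_ne_bot.2 (complement_ne_bot hk e f)
  obtain ⟨a, b, τ, haa, hbb, hab, hm⟩ := exists_darboux_pair
    (ω := (sympForm n).domRestrict₁₂ U U) (fun x y => sympForm_skew x.1 y.1)
    -- A vector of `U` orthogonal to `U` is orthogonal to everything, because any `u` can be
    -- replaced by its projection to `U`. The trace of `L j` is handled alike, as the projection
    -- preserves `L j`.
    (fun v hv => Subtype.ext <| sympForm_nondegenerate fun u => by
      rw [← form_proj v.2]
      exact hv ⟨proj e f u, h.proj_mem u⟩)
    (fun j => (L j).1.comap U.subtype)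
    (fun j v => by
      rw [Submodule.mem_comap, Submodule.subtype_apply, (L j).2.mem_iff]
      constructor
      · exact fun hv u hu => hv u.1 hu
      · intro hv u hu
        rw [← form_proj v.2]
        exact hv ⟨proj e f u, h.proj_mem u⟩ (h.proj_mem_plane j hu))
  have ha := mem_complement.1 a.2
  have hb := mem_complement.1 b.2
  have ha1 : ∀ i, sympForm n a (e i) = 0 := fun i => by simp [sympForm_skew (e i), ha]
  have ha2 : ∀ i, sympForm n a (f i) = 0 := fun i => by simp [sympForm_skew (f i), ha]
  have hb2 : ∀ i, sympForm n b (f i) = 0 := fun i => by simp [sympForm_skew (f i), hb]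
  have haa : sympForm n a a = 0 := haa
  have hbb : sympForm n b b = 0 := hbb
  have hab : sympForm n a b = 1 := hab
  refine ⟨Fin.cons a.1 e, Fin.cons b.1 f, Fin.cons τ t, ?_, ?_, ?_, ?_⟩
  · intro i j
    cases i using Fin.cases <;> cases j using Fin.cases <;> simp [haa, ha, ha1, h.form_left]
  · intro i j
    cases i using Fin.cases <;> cases j using Fin.cases <;> simp [hbb, hb, hb2, h.form_right]
  · intro i j
    cases i using Fin.cases <;> cases j using Fin.cases <;>
      simp [hab, hb, ha2, h.form_left_right, Fin.succ_ne_zero, (Fin.succ_ne_zero _).symm]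
  · intro j i
    cases i using Fin.cases with
    | zero => exact hm j
    | succ i => exact h.mem j i

end IsAdaptedFrame

theorem exists_isAdaptedFrame {n : ℕ} (L : Fin 3 → LagrangianPlane n) :
    ∃ (e f : Fin n → Cn n × Cn n) (t : Fin n → Fin 6), IsAdaptedFrame L e f t := by
  suffices H : ∀ k ≤ n, ∃ (e f : Fin k → Cn n × Cn n) (t : Fin k → Fin 6),
      IsAdaptedFrame L e f t from H n le_rfl
  intro k
  induction k with
  | zero =>
    exact fun _ => ⟨Fin.elim0, Fin.elim0, Fin.elim0, fun i => i.elim0, fun i => i.elim0,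
      fun i => i.elim0, fun _ i => i.elim0⟩
  | succ k ih =>
    intro hk
    obtain ⟨e, f, t, h⟩ := ih (by omega)
    exact h.exists_extend hk

/-! ### The model triple -/

theorem isHermitian_diagonal_intCast {n : ℕ} (d : Fin n → ℤ) :
    (Matrix.diagonal fun i => (d i : ℂ)).IsHermitian := by
  refine Matrix.isHermitian_diagonal_of_self_adjoint _ ?_
  ext i
  simp

/-- The graph of a diagonal matrix with integer entries. -/
noncomputable def diagPlane {n : ℕ} (d : Fin n → ℤ) : LagrangianPlane n :=
  graphPlane _ (isHermitian_diagonal_intCast d)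

theorem toEuclideanLin_diagonal {n : ℕ} (d : Fin n → ℂ) (x : Cn n) (i : Fin n) :
    Matrix.toEuclideanLin (Matrix.diagonal d) x i = d i * x i := by
  simp [Matrix.toLpLin_apply, Matrix.mulVec_diagonal]

theorem mem_diagPlane {n : ℕ} {d : Fin n → ℤ} {v : Cn n × Cn n} :
    v ∈ (diagPlane d).1 ↔ ∀ i, v.2 i = d i * v.1 i := by
  simp only [diagPlane, graphPlane, LinearMap.mem_graph_iff]
  constructor
  · intro h i
    rw [h, toEuclideanLin_diagonal]
  · intro h
    ext i
    rw [toEuclideanLin_diagonal, h]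

/-- Taking symplectic complements reverses inclusions and fixes both planes. -/
theorem LagrangianPlane.eq_of_le {n : ℕ} {L M : LagrangianPlane n} (h : L.1 ≤ M.1) : L = M := by
  refine Subtype.ext (le_antisymm h fun v hv => ?_)
  rw [L.2.mem_iff]
  exact fun u hu => (M.2.mem_iff v).1 hv u (h hu)

/-- The linear map that sends the standard Darboux basis to a given family. -/
noncomputable def frameMap {n : ℕ} (e f : Fin n → Cn n × Cn n) :
    (Cn n × Cn n) →ₗ[ℂ] (Cn n × Cn n) where
  toFun v := ∑ i, (v.1 i • e i + v.2 i • f i)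
  map_add' v w := by
    rw [← Finset.sum_add_distrib]
    refine Finset.sum_congr rfl fun i _ => ?_
    simp only [Prod.fst_add, Prod.snd_add, PiLp.add_apply]
    module
  map_smul' c v := by
    rw [Finset.smul_sum]
    refine Finset.sum_congr rfl fun i _ => ?_
    simp only [Prod.smul_fst, Prod.smul_snd, PiLp.smul_apply, smul_eq_mul, RingHom.id_apply]
    module

theorem frameMap_apply {n : ℕ} (e f : Fin n → Cn n × Cn n) (v : Cn n × Cn n) :
    frameMap e f v = ∑ i, (v.1 i • e i + v.2 i • f i) := rfl

theorem IsAdaptedFrame.form_frameMap {n : ℕ} {L : Fin 3 → LagrangianPlane n}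
    {e f : Fin n → Cn n × Cn n} {t : Fin n → Fin 6} (h : IsAdaptedFrame L e f t)
    (v w : Cn n × Cn n) : sympForm n (frameMap e f v) (frameMap e f w) = sympForm n v w := by
  simp only [frameMap_apply, map_sum, LinearMap.sum_apply, map_add, LinearMap.add_apply,
    LinearMap.map_smulₛₗ, LinearMap.smul_apply, h.form_left, h.form_right, h.form_left_right,
    h.form_right_left, smul_eq_mul, mul_zero, Finset.sum_const_zero, sympForm_apply,
    PiLp.inner_apply, RCLike.inner_apply, RingHom.id_apply, mul_ite, mul_one,
    Finset.sum_add_distrib, Finset.mem_univ, if_true, Finset.sum_ite_eq']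
  simp only [← Finset.sum_add_distrib, ← Finset.sum_sub_distrib]
  refine Finset.sum_congr rfl fun i _ => ?_
  ring

/-- Every triple of Lagrangian planes is symplectically equivalent to a model triple. -/
theorem IsAdaptedFrame.exists_symplectic {n : ℕ} {L : Fin 3 → LagrangianPlane n}
    {e f : Fin n → Cn n × Cn n} {t : Fin n → Fin 6} (h : IsAdaptedFrame L e f t) :
    ∃ (S : (Cn n × Cn n) ≃ₗ[ℂ] (Cn n × Cn n)) (hS : IsSymplectic S),
      ∀ j, (diagPlane fun i => lineSlope j (t i)).map S hS = L j := by
  have hinj : Function.Injective (frameMap e f) := by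
    rw [← LinearMap.ker_eq_bot, LinearMap.ker_eq_bot']
    intro v hv
    -- A map that preserves a nondegenerate form has trivial kernel.
    refine sympForm_nondegenerate fun u => ?_
    rw [← h.form_frameMap, hv, map_zero]
  refine ⟨LinearEquiv.ofInjectiveEndo (frameMap e f) hinj, h.form_frameMap, fun j => ?_⟩
  refine LagrangianPlane.eq_of_le ?_
  rintro _ ⟨v, hv, rfl⟩
  change frameMap e f v ∈ (L j).1
  rw [frameMap_apply]
  refine sum_mem fun i _ => ?_
  -- On the model plane the second coordinate is the slope times the first, so each summand is a
  -- multiple of `e i + slope • f i`.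
  rw [mem_diagPlane.1 hv i, mul_comm, mul_smul, ← smul_add]
  exact Submodule.smul_mem _ _ (h.mem j i)

/-! ### Invariants of the model triple -/

/-- The negative index is independent of the diagonalizing basis, so the diagonal entries in the
standard basis can replace the eigenvalues. -/
theorem morseIndex_diagonal {n : ℕ} (d : Fin n → ℤ) {A : Matrix (Fin n) (Fin n) ℂ}
    (hA : A.IsHermitian) (hd : A = Matrix.diagonal fun i => (d i : ℂ)) :
    morseIndex hA = Nat.card {i // d i < 0} := by
  have h := hasNegIndex_of_diag (EuclideanSpace.basisFun (Fin n) ℂ) (fun i => (d i : ℝ))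
    (matQuad A) (fun x => by
      simp only [matQuad, PiLp.inner_apply, hd, toEuclideanLin_diagonal, RCLike.inner_apply,
        Complex.re_sum, EuclideanSpace.basisFun_repr]
      refine Finset.sum_congr rfl fun i _ => ?_
      rw [mul_assoc, Complex.mul_conj', ← Complex.ofReal_pow, ← Complex.ofReal_intCast,
        ← Complex.ofReal_mul, Complex.ofReal_re])
  rw [← (hasNegIndex_matQuad hA).negIndex_eq, h.negIndex_eq]
  simp only [Int.cast_lt_zero]

/-- Two graphs meet in the kernel of the difference of their matrices, and the rank of a diagonal
matrix is its number of nonzero entries. -/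
theorem finrank_diagPlane_inf {n : ℕ} (d d' : Fin n → ℤ) :
    Module.finrank ℂ ((diagPlane d).1 ⊓ (diagPlane d').1 : Submodule ℂ (Cn n × Cn n))
      = Nat.card {i // d i = d' i} := by
  rw [diagPlane, diagPlane, finrank_graphPlane_inf, Matrix.diagonal_sub]
  have h3 := (Matrix.toEuclideanLin
    (Matrix.diagonal fun i => (d' i : ℂ) - (d i : ℂ))).finrank_range_add_finrank_ker
  have h4 := Matrix.rank_diagonal fun i => (d' i : ℂ) - (d i : ℂ)
  rw [Matrix.rank_eq_finrank_range_toLin _ (EuclideanSpace.basisFun (Fin n) ℂ).toBasis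
      (EuclideanSpace.basisFun (Fin n) ℂ).toBasis,
      ← Matrix.toEuclideanLin_eq_toLin_orthonormal, ← Nat.card_eq_fintype_card] at h4
  have h5 := card_set_add_compl {i | d i = d' i}
  have h6 : Nat.card {i // (d' i : ℂ) - (d i : ℂ) ≠ 0} = Nat.card ({i | d i = d' i}ᶜ : Set _) := by
    refine Nat.card_congr (Equiv.subtypeEquivRight fun i => ?_)
    rw [sub_ne_zero, Set.mem_compl_iff, Set.mem_ofPred_eq, Ne, Int.cast_inj, eq_comm]
  simp only [finrank_euclideanSpace, Fintype.card_fin] at h3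
  have h7 : Nat.card {i // d i = d' i} = Nat.card ({i | d i = d' i} : Set _) := rfl
  omega

theorem duistermaatIndex_diagPlane {n : ℕ} (a b c : Fin n → ℤ) :
    duistermaatIndex (diagPlane a) (diagPlane b) (diagPlane c)
      = (Nat.card {i // b i - a i < 0} : ℤ) - Nat.card {i // c i - a i < 0}
        + Nat.card {i // c i - b i < 0} := by
  rw [diagPlane, diagPlane, diagPlane, duistermaatIndex_graph,
    morseIndex_diagonal (fun i => b i - a i), morseIndex_diagonal (fun i => c i - a i),
    morseIndex_diagonal (fun i => c i - b i)] <;>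
  simp [Matrix.diagonal_sub]

/-- The number of indices of a given type. -/
def typeCount {n : ℕ} (t : Fin n → Fin 6) (τ : Fin 6) : ℕ := Fintype.card {i // t i = τ}

theorem card_type_subtype {n : ℕ} (t : Fin n → Fin 6) (P : Fin 6 → Prop) [DecidablePred P] :
    Nat.card {i // P (t i)} = ∑ τ with P τ, typeCount t τ := by
  rw [Nat.card_eq_fintype_card, Fintype.card_subtype,
    Finset.card_eq_sum_card_fiberwise (f := t) (t := Finset.univ.filter P)
      (fun i hi => by simpa using hi)]
  refine Finset.sum_congr rfl fun τ hτ => ?_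
  rw [typeCount, Fintype.card_subtype]
  congr 1
  ext i
  simp only [Finset.mem_filter, Finset.mem_univ, true_and, and_iff_right_iff_imp]
  rintro rfl
  simpa using hτ

theorem sum_typeCount {n : ℕ} (t : Fin n → Fin 6) : ∑ τ, typeCount t τ = n := by
  have h := card_type_subtype t (fun _ => True)
  simp only [Finset.filter_true] at h
  rw [← h]
  simp

/-- Two assignments of types with the same fibre cardinalities differ by a permutation. -/
theorem exists_perm_of_typeCount_eq {n : ℕ} {t t' : Fin n → Fin 6}
    (h : ∀ τ, typeCount t τ = typeCount t' τ) : ∃ σ : Equiv.Perm (Fin n), t' ∘ σ = t := by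
  -- Arbitrary bijections between fibres over the same type are glued together.
  let σ : Equiv.Perm (Fin n) := (Equiv.sigmaFiberEquiv t).symm.trans
    ((Equiv.sigmaCongrRight fun τ => Fintype.equivOfCardEq (h τ)).trans (Equiv.sigmaFiberEquiv t'))
  refine ⟨σ, funext fun i => ?_⟩
  exact (Fintype.equivOfCardEq (h (t i)) ⟨i, rfl⟩).2

/-- The invariants of a triple of Lagrangian planes agree with those of another triple. -/
def SameInvariants {n : ℕ} (L M : Fin 3 → LagrangianPlane n) : Prop :=
  (∀ j k, Module.finrank ℂ ((L j).1 ⊓ (L k).1 : Submodule ℂ (Cn n × Cn n)) =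
      Module.finrank ℂ ((M j).1 ⊓ (M k).1 : Submodule ℂ (Cn n × Cn n))) ∧
    Module.finrank ℂ ((L 0).1 ⊓ (L 1).1 ⊓ (L 2).1 : Submodule ℂ (Cn n × Cn n)) =
      Module.finrank ℂ ((M 0).1 ⊓ (M 1).1 ⊓ (M 2).1 : Submodule ℂ (Cn n × Cn n)) ∧
    duistermaatIndex (L 0) (L 1) (L 2) = duistermaatIndex (M 0) (M 1) (M 2)

theorem sameInvariants_of_map {n : ℕ} {L M : Fin 3 → LagrangianPlane n}
    (S : (Cn n × Cn n) ≃ₗ[ℂ] (Cn n × Cn n)) (hS : IsSymplectic S)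
    (h : ∀ j, (L j).map S hS = M j) : SameInvariants L M := by
  have hM : ∀ j, (M j).1 = (L j).1.map (S : (Cn n × Cn n) →ₗ[ℂ] (Cn n × Cn n)) := fun j =>
    congrArg Subtype.val (h j).symm
  refine ⟨fun j k => ?_, ?_, ?_⟩
  · rw [hM, hM, ← Submodule.map_inf _ S.injective, LinearEquiv.finrank_map_eq]
  · rw [hM, hM, hM, ← Submodule.map_inf _ S.injective, ← Submodule.map_inf _ S.injective,
      LinearEquiv.finrank_map_eq]
  · rw [← h, ← h, ← h, duistermaatIndex_map]

theorem SameInvariants.symm {n : ℕ} {L M : Fin 3 → LagrangianPlane n} (h : SameInvariants L M) :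
    SameInvariants M L :=
  ⟨fun j k => (h.1 j k).symm, h.2.1.symm, h.2.2.symm⟩

theorem SameInvariants.trans {n : ℕ} {L M N : Fin 3 → LagrangianPlane n} (h : SameInvariants L M)
    (h' : SameInvariants M N) : SameInvariants L N :=
  ⟨fun j k => (h.1 j k).trans (h'.1 j k), h.2.1.trans h'.2.1, h.2.2.trans h'.2.2⟩

/-- The model triple of Lagrangian planes with the given types. -/
noncomputable def modelTriple {n : ℕ} (t : Fin n → Fin 6) (j : Fin 3) : LagrangianPlane n :=
  diagPlane fun i => lineSlope j (t i)

theorem finrank_modelTriple_inf {n : ℕ} (t : Fin n → Fin 6) (j k : Fin 3) :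
    Module.finrank ℂ
        ((modelTriple t j).1 ⊓ (modelTriple t k).1 : Submodule ℂ (Cn n × Cn n))
      = ∑ τ with lineSlope j τ = lineSlope k τ, typeCount t τ := by
  rw [modelTriple, modelTriple, finrank_diagPlane_inf,
    card_type_subtype t fun τ => lineSlope j τ = lineSlope k τ]

theorem finrank_modelTriple_inf_inf {n : ℕ} (t : Fin n → Fin 6) :
    Module.finrank ℂ ((modelTriple t 0).1 ⊓ (modelTriple t 1).1 ⊓ (modelTriple t 2).1 :
        Submodule ℂ (Cn n × Cn n)) = typeCount t 0 := by
  -- a further diagonal graph meets the first plane exactly in the triple intersection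
  have h : (modelTriple t 0).1 ⊓ (modelTriple t 1).1 ⊓ (modelTriple t 2).1
      = (modelTriple t 0).1 ⊓
        (diagPlane fun i => lineSlope 0 (t i) + if t i = 0 then 0 else 1).1 := by
    ext v
    simp only [modelTriple, Submodule.mem_inf, mem_diagPlane]
    rw [← forall_and, ← forall_and, ← forall_and]
    refine forall_congr' fun i => ?_
    generalize t i = τ
    fin_cases τ <;> simp [lineSlope] <;> grind
  rw [h, modelTriple, finrank_diagPlane_inf,
    card_type_subtype t fun τ => lineSlope 0 τ = lineSlope 0 τ + if τ = 0 then 0 else 1,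
    show (Finset.univ.filter fun τ : Fin 6 =>
      lineSlope 0 τ = lineSlope 0 τ + if τ = 0 then 0 else 1) = {0} by decide,
    Finset.sum_singleton]

/-- For graphs the index is an alternating sum of three negative indices. The first two both count
types `3` and `5` and cancel, leaving the types whose slope decreases from the second plane to the
third. This is what separates type `5` from type `4`. -/
theorem duistermaatIndex_modelTriple {n : ℕ} (t : Fin n → Fin 6) :
    duistermaatIndex (modelTriple t 0) (modelTriple t 1) (modelTriple t 2)
      = typeCount t 2 + typeCount t 5 := by
  rw [modelTriple, modelTriple, modelTriple, duistermaatIndex_diagPlane,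
    card_type_subtype t fun τ => lineSlope 1 τ - lineSlope 0 τ < 0,
    card_type_subtype t fun τ => lineSlope 2 τ - lineSlope 0 τ < 0,
    card_type_subtype t fun τ => lineSlope 2 τ - lineSlope 1 τ < 0,
    show (Finset.univ.filter fun τ => lineSlope 1 τ - lineSlope 0 τ < 0) = {3, 5} by decide,
    show (Finset.univ.filter fun τ => lineSlope 2 τ - lineSlope 0 τ < 0) = {3, 5} by decide,
    show (Finset.univ.filter fun τ => lineSlope 2 τ - lineSlope 1 τ < 0) = {2, 5} by decide]
  simp

/-- The triple intersection yields the count of type `0`, the pairwise ones then those of types `1`,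
`2`, `3`, the index that of type `5`, and the total `n` that of type `4`. -/
theorem typeCount_eq_of_sameInvariants {n : ℕ} {t t' : Fin n → Fin 6}
    (h : SameInvariants (modelTriple t) (modelTriple t')) (τ : Fin 6) :
    typeCount t τ = typeCount t' τ := by
  obtain ⟨h2, h3, hi⟩ := h
  have h01 := h2 0 1
  have h02 := h2 0 2
  have h12 := h2 1 2
  have hs := (sum_typeCount t).trans (sum_typeCount t').symm
  rw [finrank_modelTriple_inf, finrank_modelTriple_inf,
    show (Finset.univ.filter fun τ => lineSlope 0 τ = lineSlope 1 τ) = {0, 1} by decide] at h01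
  rw [finrank_modelTriple_inf, finrank_modelTriple_inf,
    show (Finset.univ.filter fun τ => lineSlope 0 τ = lineSlope 2 τ) = {0, 2} by decide] at h02
  rw [finrank_modelTriple_inf, finrank_modelTriple_inf,
    show (Finset.univ.filter fun τ => lineSlope 1 τ = lineSlope 2 τ) = {0, 3} by decide] at h12
  rw [finrank_modelTriple_inf_inf, finrank_modelTriple_inf_inf] at h3
  rw [duistermaatIndex_modelTriple, duistermaatIndex_modelTriple] at hi
  simp only [Fin.sum_univ_six] at hs
  rw [Finset.sum_pair (by decide), Finset.sum_pair (by decide)] at h01 h02 h12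
  fin_cases τ <;> simp only [Fin.zero_eta, Fin.mk_one, Fin.reduceFinMk] <;> omega

/-! ### Classification of triples -/

theorem proposition4p2 (n : ℕ) (L M : Fin 3 → LagrangianPlane n) :
    (∃ (S : (Cn n × Cn n) ≃ₗ[ℂ] (Cn n × Cn n)) (hS : IsSymplectic S),
        ∀ j, (L j).map S hS = M j) ↔
      (∀ j k, Module.finrank ℂ ((L j).1 ⊓ (L k).1 : Submodule ℂ (Cn n × Cn n)) =
          Module.finrank ℂ ((M j).1 ⊓ (M k).1 : Submodule ℂ (Cn n × Cn n))) ∧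
        Module.finrank ℂ ((L 0).1 ⊓ (L 1).1 ⊓ (L 2).1 : Submodule ℂ (Cn n × Cn n)) =
          Module.finrank ℂ ((M 0).1 ⊓ (M 1).1 ⊓ (M 2).1 : Submodule ℂ (Cn n × Cn n)) ∧
        duistermaatIndex (L 0) (L 1) (L 2) = duistermaatIndex (M 0) (M 1) (M 2) := by
  constructor
  · rintro ⟨S, hS, h⟩
    exact sameInvariants_of_map S hS h
  · intro hinv
    obtain ⟨e, f, t, hL⟩ := exists_isAdaptedFrame L
    obtain ⟨e', f', t', hM⟩ := exists_isAdaptedFrame M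
    obtain ⟨S, hS, hSL⟩ := hL.exists_symplectic
    obtain ⟨T, hT, hTM⟩ := hM.exists_symplectic
    have hmodel : SameInvariants (modelTriple t) (modelTriple t') :=
      ((sameInvariants_of_map S hS hSL).trans hinv).trans (sameInvariants_of_map T hT hTM).symm
    obtain ⟨σ, hσ⟩ := exists_perm_of_typeCount_eq (typeCount_eq_of_sameInvariants hmodel)
    -- Permuting the planes of the frame for `M` gives both frames the type function `t`, so both
    -- triples are images of the same model.
    have hM' := hM.reindex σ
    rw [hσ] at hM'
    obtain ⟨R, hR, hRM⟩ := hM'.exists_symplectic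
    -- The required map goes from `L` back to the common model by the inverse of `S` and on to `M`
    -- by `R`.
    refine ⟨S.symm.trans R, fun x y => ?_, fun j => LagrangianPlane.eq_of_le ?_⟩
    · rw [LinearEquiv.trans_apply, LinearEquiv.trans_apply, hR, ← hS, S.apply_symm_apply,
        S.apply_symm_apply]
    · rw [← hSL j, ← hRM j]
      rintro _ ⟨_, ⟨v, hv, rfl⟩, rfl⟩
      exact ⟨v, hv, by simp⟩
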